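/- Let $k\ge 2$ be an integer. All graphs are finite, undirected and loopless, without parallel edges, with positive integer edge capacities (non-edges have capacity $0$). For a capacitated graph $(H=(V+s,E),c)$ with $|V|\ge 3$, $s\notin V$, and a biset ${\sf X}=(X_O,X_I)$ on $V$ (that is, $X_I\subseteq X_O\subseteq V$) put $w({\sf X})=X_O\setminus X_I$ and let $f_{(H,c)}({\sf X})=k|w({\sf X})|+c(\delta_H(X_I,(V+s)\setminus X_O))$, where $\delta_H(A,B)$ is the set of edges between the disjoint sets $A$ and $B$. The biset is nontrivial if $X_I\ne\emptyset$ and $X_O\neq V$. $(H,c)$ is *$(2,k)$-connected in $V$* if $f_{(H,c)}({\sf X})\ge 2k$ for every nontrivial biset ${\sf X}$ on $V$. For $0\le\alpha\le c(sv)$, $(H,c)_v^{\alpha}$ arises from $(H,c)$ by decreasing $c(sv)$ by $\alpha$. Write $N_H(s)$ for the set of neighbours of $s$, and $d_H(s)$ for the total capacity of the edges at $s$. *Minimal even extension.* Let $(G,c_0)$ be a capacitated graph with vertex set $V$, $|V|=n\ge 3$. Add a vertex $s$ and an edge $sv$ of capacity $2k$ for every $v\in V$. Choose an ordering $v_1,\dots,v_n$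 of $V$, and for $i=1,\dots,n$ in turn replace the current $(H,c)$ by $(H,c)_{v_i}^{\alpha}$ for the largest $\alpha\le c(sv_i)$ for which the result is $(2,k)$-connected in $V$. Finally, if $d_H(s)$ is odd, increase $c(sv_{i^*})$ by $1$, where $i^*$ is the largest index with $c(sv_{i^*})$ odd. Any graph obtained in this way (for some ordering) is a minimal even extension for $(2,k)$-connectivity of $(G,c_0)$. *Splitting off.* For $u,v\in N_H(s)$ (with $c(su)\ge 2$ if $u=v$), the splitting off of $(su,sv)$ decreases $c(su)$ and $c(sv)$ by $1$ each (so $c(su)$ by $2$ if $u=v$) and, if $u\ne v$, increases $c(uv)$ by $1$. It is admissible if $(H,c)$ and the resulting graph are $(2,k)$-connected in $V$. A series of admissible splitting offs is a finite, possibly empty, sequence of splitting offs each of which is admissible in the current graph; it is a complete admissible splitting off if $s$ is isolated at the end. *Obstacle.* An obstacle of $(H,c)$ consists of a collection $\mathcal B$ of nontrivial bisets on $V$ and a vertex $t\in N_H(s)$ such that (i) $c(st)$ is odd and $(H,c)_t^1$ is $(2,k)$-connected in $V$; (ii) $w({\sf B})=\{t\}$ and $f_{(H,c)}({\sf B})=2k$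 for all ${\sf B}\in\mathcal B$; (iii) $B_I\cap B'_I=\emptyset$ for all distinct ${\sf B},{\sf B}'\in\mathcal B$; (iv) $N_H(s)\setminus\{t\}\subseteq\bigcup_{{\sf B}\in\mathcal B}B_I$. **Lemma.** Let $(H,c)$ be a minimal even extension for $(2,k)$-connectivity of a capacitated graph $(G,c_0)$ with at least three vertices, and let $(H_1,c_1)$ be obtained from $(H,c)$ by a series of admissible splitting offs. Then $(H_1,c_1)$ contains no obstacle. Consequently, $(H_1,c_1)$ has a complete admissible splitting off. -/

import Mathlib

/-- A finite loopless undirected graph without parallel edges and with integer edge capacities,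
given by its symmetric capacity function; `x y` is an edge exactly when `0 < cap x y`. -/
@[ext]
structure CapGraph (W : Type*) where
  cap : W → W → ℕ
  symm : ∀ x y, cap x y = cap y x
  loopless : ∀ x, cap x x = 0

/-- A biset on `Ω`: an inner set contained in an outer set. -/
@[ext]
structure Biset (Ω : Type*) where
  outer : Finset Ω
  inner : Finset Ω
  inner_subset : inner ⊆ outer

namespace Biset

variable {Ω : Type*}

/-- The wall `X_O - X_I`. -/
def wall [DecidableEq Ω] (X : Biset Ω) : Finset Ω := X.outer \ X.inner

/-- Nontrivial with respect to the ground set `Ω`. -/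
def Nontrivial [Fintype Ω] (X : Biset Ω) : Prop :=
  X.inner.Nonempty ∧ X.outer ≠ Finset.univ

/-- A biset on `V`, viewed as a biset on `V + s` (the vertex `s` is `none : Option V`;
it lies outside of the outer set). -/
def lift {V : Type*} (X : Biset V) : Biset (Option V) where
  outer := X.outer.map Function.Embedding.some
  inner := X.inner.map Function.Embedding.some
  inner_subset := Finset.map_subset_map.2 X.inner_subset

end Biset

namespace CapGraph

section General

variable {W : Type*} [Fintype W] [DecidableEq W]

/-- The total capacity of the edges between `A - B` and `B - A`. -/
def cutCap (G : CapGraph W) (A B : Finset W) : ℕ :=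
  ∑ x ∈ A \ B, ∑ y ∈ B \ A, G.cap x y

/-- The function `f(X) = k |w(X)| + c(δ(X_I, W - X_O))` on the bisets on the vertex set `W`. -/
def f (G : CapGraph W) (k : ℕ) (X : Biset W) : ℕ :=
  k * X.wall.card + G.cutCap X.inner (Finset.univ \ X.outer)

/-- The total capacity of the edges incident to `x`. -/
def deg (G : CapGraph W) (x : W) : ℕ := ∑ y, G.cap x y

end General

section Star

/-! Graphs on `V + s` are capacitated graphs on `Option V`, with `s = none`. -/

variable {V : Type*} [Fintype V] [DecidableEq V]

/-- The capacity of the edge `sv`. -/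
def starCap (H : CapGraph (Option V)) (v : V) : ℕ := H.cap none (some v)

/-- `(H,c)` is `(2,k)`-connected in `V`. -/
def ConnectedIn (H : CapGraph (Option V)) (k : ℕ) : Prop :=
  3 ≤ Fintype.card V ∧ ∀ X : Biset V, X.Nontrivial → 2 * k ≤ H.f k X.lift

/-- `(H,c)_v^α`: decrease the capacity of `sv` by `α`; only used for `α ≤ c(sv)`. -/
def decStar (H : CapGraph (Option V)) (v : V) (α : ℕ) : CapGraph (Option V) where
  cap x y := if s(x, y) = s(none, some v) then H.cap x y - α else H.cap x y
  symm x y := by rw [Sym2.eq_swap, H.symm x y]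
  loopless x := by simp [H.loopless]

/-- Increase the capacity of `sv` by `α`. -/
def incStar (H : CapGraph (Option V)) (v : V) (α : ℕ) : CapGraph (Option V) where
  cap x y := if s(x, y) = s(none, some v) then H.cap x y + α else H.cap x y
  symm x y := by rw [Sym2.eq_swap, H.symm x y]
  loopless x := by
    have h : s(x, x) ≠ s(none, some v) := by
      intro h
      rcases Sym2.eq_iff.1 h with ⟨h1, h2⟩ | ⟨h1, h2⟩ <;> simp [h1] at h2
    simp [H.loopless, h]

open Classical in
/-- `(H,c)_v^max = (H,c)_v^α` for the maximum integer `α ≤ c(sv)` such that `(H,c)_v^α` is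
`(2,k)`-connected in `V`. -/
noncomputable def decStarMax (k : ℕ) (H : CapGraph (Option V)) (v : V) : CapGraph (Option V) :=
  H.decStar v (Nat.findGreatest (fun α => (H.decStar v α).ConnectedIn k) (H.starCap v))

/-- The graph on `V + s` obtained from `G` by adding the vertex `s` and an edge of capacity `m`
between `s` and every vertex of `V`. -/
def addStar (G : CapGraph V) (m : ℕ) : CapGraph (Option V) where
  cap
    | none, none => 0
    | none, some _ => m
    | some _, none => m
    | some x, some y => G.cap x y
  symm x y := by cases x <;> cases y <;> simp [G.symm]
  loopless x := by cases x <;> simp [G.loopless]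

/-- The greedy reduction: start with capacity `2k` on every edge `sv`, then process the vertices in
the order `v 0, …, v (n-1)`, each time replacing `(H,c)` by `(H,c)_{v i}^max`. -/
noncomputable def greedyExtension (k : ℕ) (G : CapGraph V) (v : Fin (Fintype.card V) ≃ V) :
    CapGraph (Option V) :=
  (List.ofFn v).foldl (decStarMax k) (G.addStar (2 * k))

/-- `H` is a minimal even extension for `(2,k)`-connectivity of `G`: for some ordering of the
vertices it is the result of the greedy reduction, where, if the degree of `s` is odd, the capacity
of the last edge `s (v i)` of odd capacity is increased by one. -/
def IsMinimalEvenExtension (k : ℕ) (G : CapGraph V) (H : CapGraph (Option V)) : Prop :=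
  ∃ v : Fin (Fintype.card V) ≃ V,
    (Even ((greedyExtension k G v).deg none) ∧ H = greedyExtension k G v) ∨
    (Odd ((greedyExtension k G v).deg none) ∧
      ∃ i, IsGreatest {j | Odd ((greedyExtension k G v).starCap (v j))} i ∧
        H = (greedyExtension k G v).incStar (v i) 1)

/-- The edges `su` and `sv` can be split off: both have positive capacity, and if `u = v`
then there are two units of capacity to be removed from this edge. -/
def CanSplit (H : CapGraph (Option V)) (u v : V) : Prop :=
  1 ≤ H.starCap u ∧ 1 ≤ H.starCap v ∧ (u = v → 2 ≤ H.starCap u)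

/-- `(H,c)_{u,v}^1`: decrease `c(su)` and `c(sv)` by one (hence `c(su)` by two if `u = v`)
and increase `c(uv)` by one if `u ≠ v`; only used if `H.CanSplit u v`. -/
def splitOff (H : CapGraph (Option V)) (u v : V) : CapGraph (Option V) where
  cap x y := H.cap x y
    - ((if s(x, y) = s(none, some u) then 1 else 0) + (if s(x, y) = s(none, some v) then 1 else 0))
    + (if u ≠ v ∧ s(x, y) = s(some u, some v) then 1 else 0)
  symm x y := by rw [Sym2.eq_swap, H.symm x y]
  loopless x := by
    have h : ¬ (u ≠ v ∧ s(x, x) = s(some u, some v)) := by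
      rintro ⟨huv, h⟩
      rcases Sym2.eq_iff.1 h with ⟨h1, h2⟩ | ⟨h1, h2⟩
      · exact huv (Option.some.inj (h1.symm.trans h2))
      · exact huv (Option.some.inj (h2.symm.trans h1))
    rw [if_neg h, H.loopless, Nat.zero_sub]

/-- The pair `(su, sv)` is admissible. -/
def Admissible (k : ℕ) (H : CapGraph (Option V)) (u v : V) : Prop :=
  H.CanSplit u v ∧ H.ConnectedIn k ∧ (H.splitOff u v).ConnectedIn k

/-- `H'` is obtained from `H` by a (possibly empty) series of splitting offs, each of which is
admissible in the current graph. -/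
def AdmissibleSeries (k : ℕ) : CapGraph (Option V) → CapGraph (Option V) → Prop :=
  Relation.ReflTransGen fun H H' => ∃ u v, H.Admissible k u v ∧ H' = H.splitOff u v

/-- There is a complete admissible splitting off at `s`. -/
def HasCompleteAdmissibleSplittingOff (k : ℕ) (H : CapGraph (Option V)) : Prop :=
  ∃ H', AdmissibleSeries k H H' ∧ ∀ v, H'.starCap v = 0

/-- The neighbours of `s`. -/
def starNbhd (H : CapGraph (Option V)) : Set V := {v | 0 < H.starCap v}

/-- `U_{(H,c)}`: the vertices `v` such that `(H,c)_v^1` is defined and `(2,k)`-connected in `V`. -/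
def U (k : ℕ) (H : CapGraph (Option V)) : Set V :=
  {v | 1 ≤ H.starCap v ∧ (H.decStar v 1).ConnectedIn k}

/-- The collection `𝓑` of nontrivial bisets on `V` and the special vertex `t` form an obstacle. -/
structure IsObstacle (k : ℕ) (H : CapGraph (Option V)) (𝓑 : Set (Biset V)) (t : V) : Prop where
  special_mem : t ∈ H.starNbhd
  special_odd : Odd (H.starCap t)
  special_mem_U : t ∈ H.U k
  nontrivial : ∀ B ∈ 𝓑, B.Nontrivial
  wall_eq : ∀ B ∈ 𝓑, B.wall = {t}
  f_eq : ∀ B ∈ 𝓑, H.f k B.lift = 2 * k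
  disjoint : ∀ B ∈ 𝓑, ∀ B' ∈ 𝓑, B ≠ B' → Disjoint B.inner B'.inner
  covering : H.starNbhd \ {t} ⊆ ⋃ B ∈ 𝓑, (B.inner : Set V)

end Star

end CapGraph

/-!
Call a nontrivial biset `X` with `f(X) = 2k` tight, and one with `f(X) ≤ 2k + 1` dangerous. All
arguments uncross tight and dangerous bisets, by submodularity (`f_inter_add_f_union_le`) and by
posimodularity (`f_sdiff_add_f_sdiff_le`). Both are used with the edges that are lost on the smaller
side. These edges matter in the degenerate cases, where an intersection or a difference is trivial,
because at least about `k` edges join the inner set of a tight or dangerous biset to its wall if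
this wall is a single vertex (`ConnectedIn.le_f_add_pairCap_wall`).

In the greedy extension every neighbour of `s` is in the inner set of a tight biset, since its
capacity cannot be decreased any further. Hence in a minimal even extension, and after any series of
admissible splitting offs, every neighbour of `s` is in the inner set of a dangerous biset, and the
degree of `s` is even (`IsNearlyTight`).

This excludes obstacles (`IsObstacle.lt_f`). Take a maximal dangerous biset `Z` with the special
vertex `t` in its inner set. A member `B` of the obstacle lies below `Z`, or else the outer sets of `Z`
and `B` cover `V`, the edge `st` has capacity one, and no neighbour of `s` is in both inner sets. The
second case occurs for at most one member. In either case, comparing `Z` and `B` with their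
complements shows that the degree of `s` is odd.

An admissible pair exists whenever there is no obstacle, the degree of `s` is even, and `s` is not
isolated (`exists_admissible`). If no neighbour of `s` is in a tight inner set, then dangerous bisets
uncross as if they were tight (`exists_admissible_of_nbhd_subset_U`). Otherwise let `t` be a
neighbour of `s` in the inner set of a maximal tight biset `X`, and suppose that `t` is in no
admissible pair (`exists_isObstacle`). All tight bisets that block a pair `(t, v)` by their wall lie
below `X`, so the neighbours of `s` outside of `X` are covered by dangerous extensions of `X`. Two of
them that cross satisfy all inequalities with equality (`IsCrossing`), and three that cross pairwise
would pairwise intersect in `X`, so that a single edge would leave `X`, which contradicts `k ≥ 2`.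
So the outer sets of two of them, `Y` and `Z`, cover the neighbours of `s`. By parity their walls are
the same vertex `y`, with `sy` of odd capacity, and `X`, `Y - Z`, `Z - Y` form an obstacle with special
vertex `y`.
-/

/-! ### Operations on bisets -/

namespace Biset

section Order

variable {Ω : Type*}

/-- The biset with empty wall given by a set. -/
def ofSet (A : Finset Ω) : Biset Ω := ⟨A, A, Finset.Subset.refl A⟩

/-- Bisets are ordered by inclusion of both the inner and the outer sets. -/
instance : PartialOrder (Biset Ω) where
  le X Y := X.inner ⊆ Y.inner ∧ X.outer ⊆ Y.outer
  le_refl _ := ⟨subset_rfl, subset_rfl⟩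
  le_trans _ _ _ h h' := ⟨h.1.trans h'.1, h.2.trans h'.2⟩
  le_antisymm _ _ h h' := Biset.ext (h.2.antisymm h'.2) (h.1.antisymm h'.1)

@[simp] theorem inner_ofSet (A : Finset Ω) : (ofSet A).inner = A := rfl
@[simp] theorem outer_ofSet (A : Finset Ω) : (ofSet A).outer = A := rfl

instance [Finite Ω] : Finite (Biset Ω) :=
  Finite.of_injective (fun X : Biset Ω => (X.outer, X.inner)) fun X Y h => by
    simp only [Prod.mk.injEq] at h
    exact Biset.ext h.1 h.2

/-- On a finite ground set, every biset with a given property lies below one that is maximal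
with this property. -/
theorem exists_le_maximal [Finite Ω] {P : Biset Ω → Prop} {X : Biset Ω} (hX : P X) :
    ∃ Z, X ≤ Z ∧ Maximal P Z :=
  (Set.toFinite {X | P X}).exists_le_maximal hX

theorem nontrivial_of_mem [Fintype Ω] {X : Biset Ω} {x y : Ω} (hx : x ∈ X.inner)
    (hy : y ∉ X.outer) : X.Nontrivial :=
  ⟨⟨x, hx⟩, fun h => hy (h ▸ Finset.mem_univ y)⟩

theorem Nontrivial.exists_notMem [Fintype Ω] {X : Biset Ω} (hX : X.Nontrivial) :
    ∃ x, x ∉ X.outer := by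
  by_contra! h
  exact hX.2 (Finset.eq_univ_iff_forall.2 h)

end Order

variable {Ω : Type*} [DecidableEq Ω]

instance : Inter (Biset Ω) where
  inter X Y := ⟨X.outer ∩ Y.outer, X.inner ∩ Y.inner,
    Finset.inter_subset_inter X.inner_subset Y.inner_subset⟩

instance : Union (Biset Ω) where
  union X Y := ⟨X.outer ∪ Y.outer, X.inner ∪ Y.inner,
    Finset.union_subset_union X.inner_subset Y.inner_subset⟩

/-- The outer set of the difference is `X_O - Y_I`, and its inner set is `X_I - Y_O`. -/
instance : SDiff (Biset Ω) where
  sdiff X Y := ⟨X.outer \ Y.inner, X.inner \ Y.outer,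
    Finset.sdiff_subset_sdiff X.inner_subset Y.inner_subset⟩

/-- The biset complement exchanges the inner set with the complement of the outer set, so that the
wall is kept. -/
instance [Fintype Ω] : Compl (Biset Ω) where
  compl X := ⟨X.innerᶜ, X.outerᶜ, Finset.compl_subset_compl.2 X.inner_subset⟩

@[simp] theorem inner_inter (X Y : Biset Ω) : (X ∩ Y).inner = X.inner ∩ Y.inner := rfl
@[simp] theorem outer_inter (X Y : Biset Ω) : (X ∩ Y).outer = X.outer ∩ Y.outer := rfl
@[simp] theorem inner_union (X Y : Biset Ω) : (X ∪ Y).inner = X.inner ∪ Y.inner := rfl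
@[simp] theorem outer_union (X Y : Biset Ω) : (X ∪ Y).outer = X.outer ∪ Y.outer := rfl
@[simp] theorem inner_sdiff (X Y : Biset Ω) : (X \ Y).inner = X.inner \ Y.outer := rfl
@[simp] theorem outer_sdiff (X Y : Biset Ω) : (X \ Y).outer = X.outer \ Y.inner := rfl
@[simp] theorem inner_compl [Fintype Ω] (X : Biset Ω) : (Xᶜ).inner = X.outerᶜ := rfl
@[simp] theorem outer_compl [Fintype Ω] (X : Biset Ω) : (Xᶜ).outer = X.innerᶜ := rfl
theorem mem_wall {X : Biset Ω} {x : Ω} : x ∈ X.wall ↔ x ∈ X.outer ∧ x ∉ X.inner := by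
  simp [wall]

@[simp] theorem wall_ofSet (A : Finset Ω) : (ofSet A).wall = ∅ := by simp [wall]

theorem wall_compl [Fintype Ω] (X : Biset Ω) : (Xᶜ).wall = X.wall := by
  ext x; simp [mem_wall, and_comm]

theorem Nontrivial.compl [Fintype Ω] {X : Biset Ω} (hX : X.Nontrivial) : (Xᶜ).Nontrivial := by
  obtain ⟨h1, h2⟩ := hX
  refine ⟨?_, ?_⟩
  · rw [inner_compl, Finset.nonempty_iff_ne_empty, Ne, Finset.compl_eq_empty_iff]
    exact h2
  · rw [outer_compl, Ne, Finset.compl_eq_univ_iff, ← Ne, ← Finset.nonempty_iff_ne_empty]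
    exact h1

theorem le_union_left (X Y : Biset Ω) : X ≤ X ∪ Y :=
  ⟨Finset.subset_union_left, Finset.subset_union_left⟩

theorem le_union_right (X Y : Biset Ω) : Y ≤ X ∪ Y :=
  ⟨Finset.subset_union_right, Finset.subset_union_right⟩

theorem le_inter {X Y Z : Biset Ω} (h : X ≤ Y) (h' : X ≤ Z) : X ≤ Y ∩ Z :=
  ⟨Finset.subset_inter h.1 h'.1, Finset.subset_inter h.2 h'.2⟩

end Biset

/-! ### The biset function and its uncrossing inequalities -/

namespace CapGraph

variable {V : Type*}

/-- The total capacity of the edges between `s` and `A ⊆ V`. -/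
def starSum (H : CapGraph (Option V)) (A : Finset V) : ℕ := ∑ v ∈ A, H.starCap v

/-- The total capacity of the pairs in `A × B`; this is the capacity of the cut between `A` and `B`
when `A` and `B` are disjoint subsets of `V`. -/
def pairCap (H : CapGraph (Option V)) (A B : Finset V) : ℕ :=
  ∑ x ∈ A, ∑ y ∈ B, H.cap (some x) (some y)

theorem pairCap_comm (H : CapGraph (Option V)) (A B : Finset V) :
    H.pairCap A B = H.pairCap B A := by
  rw [pairCap, Finset.sum_comm]
  simp only [H.symm (some _) (some _)]
  rfl

variable [Fintype V] [DecidableEq V]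

theorem f_lift (H : CapGraph (Option V)) (k : ℕ) (X : Biset V) :
    H.f k X.lift = k * X.wall.card + H.starSum X.inner + H.pairCap X.inner X.outerᶜ := by
  have hw : X.lift.wall.card = X.wall.card := by
    have : X.lift.wall = X.wall.map Function.Embedding.some := by
      ext x; cases x <;> simp [Biset.wall, Biset.lift]
    rw [this, Finset.card_map]
  have h1 : X.lift.inner \ (Finset.univ \ X.lift.outer) = X.inner.map Function.Embedding.some := by
    ext x
    cases x with
    | none => simp [Biset.lift]
    | some x => simpa [Biset.lift] using fun h => X.inner_subset h
  have h2 : (Finset.univ \ X.lift.outer) \ X.lift.inner = Finset.insertNone X.outerᶜ := by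
    ext x
    cases x with
    | none => simp [Biset.lift]
    | some x => simpa [Biset.lift] using fun h h' => h (X.inner_subset h')
  rw [f, hw, cutCap, h1, h2, add_assoc, starSum, pairCap, ← Finset.sum_add_distrib, Finset.sum_map]
  congr 1
  refine Finset.sum_congr rfl fun x _ => ?_
  have : Finset.insertNone X.outerᶜ = Finset.cons none (X.outerᶜ.map Function.Embedding.some)
      (by simp) := by
    ext x; cases x <;> simp
  rw [this, Finset.sum_cons, Finset.sum_map]
  simp only [Function.Embedding.some_apply]
  rw [H.symm (some x) none]
  rfl

theorem starSum_eq_sum (H : CapGraph (Option V)) (A : Finset V) :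
    H.starSum A = ∑ v, H.starCap v * (decide (v ∈ A)).toNat := by
  rw [starSum, ← Finset.sum_subset A.subset_univ (fun x _ hx => by simp [hx])]
  exact Finset.sum_congr rfl fun x hx => by simp [hx]

theorem pairCap_eq_sum (H : CapGraph (Option V)) (A B : Finset V) :
    H.pairCap A B =
      ∑ x, ∑ y, H.cap (some x) (some y) * (decide (x ∈ A) && decide (y ∈ B)).toNat := by
  have h : ∀ x y, H.cap (some x) (some y) * (decide (x ∈ A) && decide (y ∈ B)).toNat =
      if x ∈ A then (if y ∈ B then H.cap (some x) (some y) else 0) else 0 := by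
    intro x y
    by_cases hx : x ∈ A <;> by_cases hy : y ∈ B <;> simp [hx, hy]
  simp only [h, pairCap]
  rw [← Finset.sum_subset A.subset_univ (fun x _ hx => by simp [hx])]
  refine Finset.sum_congr rfl fun x hx => ?_
  rw [← Finset.sum_subset B.subset_univ (fun y _ hy => by simp [hy])]
  exact Finset.sum_congr rfl fun y hy => by simp [hx, hy]

theorem card_eq_sum_toNat (A : Finset V) : A.card = ∑ v, (decide (v ∈ A)).toNat := by
  rw [← Finset.sum_subset A.subset_univ (fun x _ hx => by simp [hx]), Finset.card_eq_sum_ones]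
  exact Finset.sum_congr rfl fun x hx => by simp [hx]

/-- Submodularity, with the contribution of the pairs between `X_I ∩ w(Y)` and `Y_I - X_O`. -/
theorem f_inter_add_f_union_le (H : CapGraph (Option V)) (k : ℕ) (X Y : Biset V) :
    H.f k (X ∩ Y).lift + H.f k (X ∪ Y).lift + H.pairCap (X.inner ∩ Y.wall) (Y.inner \ X.outer) ≤
      H.f k X.lift + H.f k Y.lift := by
  have hw : (X ∩ Y).wall.card + (X ∪ Y).wall.card ≤ X.wall.card + Y.wall.card := by
    simp only [card_eq_sum_toNat, ← Finset.sum_add_distrib]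
    refine Finset.sum_le_sum fun v _ => ?_
    have h1 := @X.inner_subset v
    have h2 := @Y.inner_subset v
    simp only [Biset.wall, Finset.mem_sdiff, Biset.inner_inter, Biset.outer_inter,
      Biset.inner_union, Biset.outer_union, Finset.mem_inter, Finset.mem_union]
    by_cases v ∈ X.inner <;> by_cases v ∈ X.outer <;> by_cases v ∈ Y.inner <;>
      by_cases v ∈ Y.outer <;> simp_all
  have hs : H.starSum (X ∩ Y).inner + H.starSum (X ∪ Y).inner =
      H.starSum X.inner + H.starSum Y.inner := by
    rw [starSum, starSum, add_comm]
    exact Finset.sum_union_inter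
  have he : H.pairCap (X ∩ Y).inner (X ∩ Y).outerᶜ + H.pairCap (X ∪ Y).inner (X ∪ Y).outerᶜ +
      H.pairCap (X.inner ∩ Y.wall) (Y.inner \ X.outer) ≤
      H.pairCap X.inner X.outerᶜ + H.pairCap Y.inner Y.outerᶜ := by
    simp only [pairCap_eq_sum, ← Finset.sum_add_distrib]
    refine Finset.sum_le_sum fun x _ => Finset.sum_le_sum fun y _ => ?_
    simp only [← Nat.mul_add]
    refine Nat.mul_le_mul_left _ ?_
    have h1 : decide (x ∈ X.inner) = true → decide (x ∈ X.outer) = true := by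
      simpa using @X.inner_subset x
    have h2 : decide (x ∈ Y.inner) = true → decide (x ∈ Y.outer) = true := by
      simpa using @Y.inner_subset x
    have h3 : decide (y ∈ X.inner) = true → decide (y ∈ X.outer) = true := by
      simpa using @X.inner_subset y
    have h4 : decide (y ∈ Y.inner) = true → decide (y ∈ Y.outer) = true := by
      simpa using @Y.inner_subset y
    simp only [Biset.wall, Finset.mem_sdiff, Biset.inner_inter, Biset.outer_inter,
      Biset.inner_union, Biset.outer_union, Finset.mem_inter, Finset.mem_union,
      Finset.mem_compl, Bool.decide_and, Bool.decide_or, decide_not]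
    revert h1 h2 h3 h4
    generalize decide (x ∈ X.inner) = a, decide (x ∈ X.outer) = b, decide (x ∈ Y.inner) = c,
      decide (x ∈ Y.outer) = d, decide (y ∈ X.inner) = a', decide (y ∈ X.outer) = b',
      decide (y ∈ Y.inner) = c', decide (y ∈ Y.outer) = d'
    revert a b c d a' b' c' d'
    decide
  rw [f_lift, f_lift, f_lift, f_lift]
  have := Nat.mul_le_mul_left k hw
  rw [Nat.mul_add, Nat.mul_add] at this
  omega

/-- Posimodularity, with the contributions of the edges that the two differences do not see. -/
theorem f_sdiff_add_f_sdiff_le (H : CapGraph (Option V)) (k : ℕ) (X Y : Biset V) :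
    H.f k (X \ Y).lift + H.f k (Y \ X).lift + 2 * H.starSum (X.inner ∩ Y.inner) +
      H.starSum (X.inner ∩ Y.wall) + H.starSum (Y.inner ∩ X.wall) +
      2 * H.pairCap (X.inner ∩ Y.inner) (X.outer ∪ Y.outer)ᶜ +
      H.pairCap (X.inner ∩ Y.inner) (X.wall \ Y.outer) +
      H.pairCap (X.inner ∩ Y.inner) (Y.wall \ X.outer) ≤
      H.f k X.lift + H.f k Y.lift := by
  have hw : (X \ Y).wall.card + (Y \ X).wall.card ≤ X.wall.card + Y.wall.card := by
    simp only [card_eq_sum_toNat, ← Finset.sum_add_distrib]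
    refine Finset.sum_le_sum fun v _ => ?_
    have h1 := @X.inner_subset v
    have h2 := @Y.inner_subset v
    simp only [Biset.wall, Finset.mem_sdiff, Biset.inner_sdiff, Biset.outer_sdiff]
    by_cases v ∈ X.inner <;> by_cases v ∈ X.outer <;> by_cases v ∈ Y.inner <;>
      by_cases v ∈ Y.outer <;> simp_all
  have hs : H.starSum (X \ Y).inner + H.starSum (Y \ X).inner +
      2 * H.starSum (X.inner ∩ Y.inner) + H.starSum (X.inner ∩ Y.wall) +
      H.starSum (Y.inner ∩ X.wall) ≤ H.starSum X.inner + H.starSum Y.inner := by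
    simp only [starSum_eq_sum, ← Finset.sum_add_distrib, Finset.mul_sum]
    refine Finset.sum_le_sum fun v _ => ?_
    simp only [Nat.mul_left_comm 2, ← Nat.mul_add]
    refine Nat.mul_le_mul_left _ ?_
    have h1 := @X.inner_subset v
    have h2 := @Y.inner_subset v
    simp only [Biset.wall, Finset.mem_sdiff, Biset.inner_sdiff, Finset.mem_inter]
    by_cases v ∈ X.inner <;> by_cases v ∈ X.outer <;> by_cases v ∈ Y.inner <;>
      by_cases v ∈ Y.outer <;> simp_all
  have he : H.pairCap (X \ Y).inner (X \ Y).outerᶜ + H.pairCap (Y \ X).inner (Y \ X).outerᶜ +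
      2 * H.pairCap (X.inner ∩ Y.inner) (X.outer ∪ Y.outer)ᶜ +
      H.pairCap (X.inner ∩ Y.inner) (X.wall \ Y.outer) +
      H.pairCap (X.inner ∩ Y.inner) (Y.wall \ X.outer) ≤
      H.pairCap X.inner X.outerᶜ + H.pairCap Y.inner Y.outerᶜ := by
    -- The inequality holds for unordered pairs only, so every term is counted in both orders.
    have two : ∀ A B, 2 * H.pairCap A B = ∑ x, ∑ y, H.cap (some x) (some y) *
        ((decide (x ∈ A) && decide (y ∈ B)).toNat +
          (decide (x ∈ B) && decide (y ∈ A)).toNat) := by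
      intro A B
      simp only [Nat.mul_add, Finset.sum_add_distrib, ← pairCap_eq_sum]
      rw [H.pairCap_comm B A, two_mul]
    refine le_of_mul_le_mul_left ?_ (Nat.zero_lt_two)
    simp only [Nat.mul_add, two, Finset.mul_sum, Nat.mul_left_comm 2]
    simp only [← Finset.sum_add_distrib]
    refine Finset.sum_le_sum fun x _ => Finset.sum_le_sum fun y _ => ?_
    simp only [← Nat.mul_add]
    refine Nat.mul_le_mul_left _ ?_
    have h1 : decide (x ∈ X.inner) = true → decide (x ∈ X.outer) = true := by
      simpa using @X.inner_subset x
    have h2 : decide (x ∈ Y.inner) = true → decide (x ∈ Y.outer) = true := by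
      simpa using @Y.inner_subset x
    have h3 : decide (y ∈ X.inner) = true → decide (y ∈ X.outer) = true := by
      simpa using @X.inner_subset y
    have h4 : decide (y ∈ Y.inner) = true → decide (y ∈ Y.outer) = true := by
      simpa using @Y.inner_subset y
    simp only [Biset.wall, Finset.mem_sdiff, Biset.inner_sdiff, Biset.outer_sdiff,
      Finset.mem_inter, Finset.mem_union, Finset.mem_compl, Bool.decide_and, Bool.decide_or,
      decide_not]
    revert h1 h2 h3 h4
    generalize decide (x ∈ X.inner) = a, decide (x ∈ X.outer) = b, decide (x ∈ Y.inner) = c,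
      decide (x ∈ Y.outer) = d, decide (y ∈ X.inner) = a', decide (y ∈ X.outer) = b',
      decide (y ∈ Y.inner) = c', decide (y ∈ Y.outer) = d'
    revert a b c d a' b' c' d'
    decide
  rw [f_lift, f_lift, f_lift, f_lift]
  have := Nat.mul_le_mul_left k hw
  rw [Nat.mul_add, Nat.mul_add] at this
  omega

end CapGraph

namespace CapGraph

section StarSum

variable {V : Type*} {H : CapGraph (Option V)}

theorem starSum_singleton (v : V) : H.starSum {v} = H.starCap v := Finset.sum_singleton _ _

theorem starSum_mono {A B : Finset V} (h : A ⊆ B) : H.starSum A ≤ H.starSum B :=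
  Finset.sum_le_sum_of_subset h

theorem starCap_le_starSum {v : V} {A : Finset V} (h : v ∈ A) : H.starCap v ≤ H.starSum A :=
  Finset.single_le_sum (f := H.starCap) (fun _ _ => Nat.zero_le _) h

theorem starCap_add_le_starSum {u v : V} {A : Finset V} (hu : u ∈ A) (hv : v ∈ A) (huv : u ≠ v) :
    H.starCap u + H.starCap v ≤ H.starSum A :=
  Finset.add_le_sum (f := H.starCap) (fun _ _ => Nat.zero_le _) hu hv huv

theorem exists_mem_of_starSum_pos {A : Finset V} (h : 0 < H.starSum A) :
    ∃ v ∈ A, 0 < H.starCap v := by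
  by_contra! hA
  exact h.ne' (Finset.sum_eq_zero fun v hv => Nat.le_zero.1 (hA v hv))

theorem starSum_eq_zero {A : Finset V} (h : ∀ v ∈ A, ¬ 0 < H.starCap v) : H.starSum A = 0 :=
  Finset.sum_eq_zero fun v hv => Nat.eq_zero_of_not_pos (h v hv)

variable [DecidableEq V]

theorem starSum_union {A B : Finset V} (h : Disjoint A B) :
    H.starSum (A ∪ B) = H.starSum A + H.starSum B :=
  Finset.sum_union h

/-- Only the neighbours of `s` matter for `starSum`. -/
theorem starSum_le_of_nbhd {A B : Finset V} (h : ∀ v ∈ A, 0 < H.starCap v → v ∈ B) :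
    H.starSum A ≤ H.starSum B := by
  have h1 : H.starSum (A \ B) = 0 := starSum_eq_zero fun v hv hpos =>
    (Finset.mem_sdiff.1 hv).2 (h v (Finset.mem_sdiff.1 hv).1 hpos)
  calc H.starSum A ≤ H.starSum ((A \ B) ∪ B) :=
        starSum_mono (by rw [Finset.sdiff_union_self_eq_union]; exact Finset.subset_union_left)
    _ = H.starSum B := by rw [starSum_union Finset.sdiff_disjoint, h1, zero_add]

end StarSum

variable {V : Type*}

theorem deg_none [Fintype V] (H : CapGraph (Option V)) : H.deg none = H.starSum Finset.univ := by
  rw [deg, Fintype.sum_option, H.loopless, zero_add]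
  rfl

variable [Fintype V] [DecidableEq V] {H : CapGraph (Option V)} {k : ℕ}

theorem ConnectedIn.le_f (hH : H.ConnectedIn k) {X : Biset V} (hX : X.Nontrivial) :
    2 * k ≤ H.f k X.lift :=
  hH.2 X hX

theorem mul_card_wall_add_starSum_le_f (X : Biset V) :
    k * X.wall.card + H.starSum X.inner ≤ H.f k X.lift := by
  rw [f_lift]; omega

theorem two_mul_le_f_of_mem_wall {X : Biset V} {x y : V} (hx : x ∈ X.wall) (hy : y ∈ X.wall)
    (hxy : x ≠ y) : 2 * k ≤ H.f k X.lift := by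
  have h1 : 2 ≤ X.wall.card := Finset.one_lt_card.2 ⟨x, hx, y, hy, hxy⟩
  have h2 := Nat.mul_le_mul_left k h1
  have h3 := mul_card_wall_add_starSum_le_f (H := H) (k := k) X
  omega

theorem f_compl_add (H : CapGraph (Option V)) (k : ℕ) (X : Biset V) :
    H.f k (Xᶜ).lift + H.starSum X.inner = H.f k X.lift + H.starSum X.outerᶜ := by
  rw [f_lift, f_lift, Biset.wall_compl, Biset.inner_compl, Biset.outer_compl, compl_compl,
    pairCap_comm]
  omega

/-- A biset with small value has at most about half of the edges at `s` in its inner set. -/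
theorem ConnectedIn.starSum_inner_le (hH : H.ConnectedIn k) {X : Biset V} (hX : X.Nontrivial) :
    2 * k + H.starSum X.inner ≤ H.f k X.lift + H.starSum X.outerᶜ := by
  have h1 := hH.le_f hX.compl
  have h2 := f_compl_add H k X
  omega

/-- If the wall of `X` is a single vertex, then many edges join it to the inner set, because the
inner set alone has degree at least `2k`. -/
theorem ConnectedIn.le_f_add_pairCap_wall (hH : H.ConnectedIn k) {X : Biset V}
    (hX : X.Nontrivial) (hw : X.wall.card = 1) :
    3 * k ≤ H.f k X.lift + H.pairCap X.inner X.wall := by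
  have h1 : (Biset.ofSet X.inner).Nontrivial :=
    ⟨hX.1, fun h => hX.2 (Finset.univ_subset_iff.1 (h ▸ X.inner_subset))⟩
  have h2 := hH.le_f h1
  have h3 : X.innerᶜ = X.outerᶜ ∪ X.wall := by
    ext x
    have := @X.inner_subset x
    simp only [Finset.mem_compl, Finset.mem_union, Biset.mem_wall]
    tauto
  have h4 : Disjoint X.outerᶜ X.wall := by
    rw [Finset.disjoint_left]
    intro x hx hx'
    exact (Finset.mem_compl.1 hx) (Biset.mem_wall.1 hx').1
  have h5 : H.pairCap X.inner X.innerᶜ = H.pairCap X.inner X.outerᶜ + H.pairCap X.inner X.wall := by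
    rw [h3]
    simp only [pairCap, Finset.sum_union h4, Finset.sum_add_distrib]
  rw [f_lift] at h2 ⊢
  simp only [Biset.wall_ofSet, Biset.inner_ofSet, Biset.outer_ofSet, Finset.card_empty] at h2
  rw [hw]
  omega

/-! ### The biset function of modified graphs -/

section Modified

variable {V : Type*} [DecidableEq V]

theorem starCap_decStar (H : CapGraph (Option V)) (v u : V) (α : ℕ) :
    (H.decStar v α).starCap u = if u = v then H.starCap u - α else H.starCap u := by
  simp [starCap, decStar]

theorem starCap_incStar (H : CapGraph (Option V)) (v u : V) (α : ℕ) :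
    (H.incStar v α).starCap u = if u = v then H.starCap u + α else H.starCap u := by
  simp [starCap, incStar]

theorem starCap_splitOff (H : CapGraph (Option V)) (u v w : V) :
    (H.splitOff u v).starCap w =
      H.starCap w - ((if w = u then 1 else 0) + (if w = v then 1 else 0)) := by
  simp [starCap, splitOff]

theorem pairCap_splitOff (H : CapGraph (Option V)) {u v : V} (huv : u ≠ v) (A B : Finset V)
    (hAB : Disjoint A B) :
    (H.splitOff u v).pairCap A B =
      H.pairCap A B + (if u ∈ A ∧ v ∈ B ∨ v ∈ A ∧ u ∈ B then 1 else 0) := by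
  have h1 : ∀ x y, (H.splitOff u v).cap (some x) (some y) = H.cap (some x) (some y) +
      ((if x = u then (if y = v then 1 else 0) else 0) +
        (if x = v then (if y = u then 1 else 0) else 0)) := by
    intro x y
    have hvu := huv.symm
    simp only [splitOff, Sym2.eq_iff, reduceCtorEq, Option.some.injEq]
    by_cases hx : x = u <;> by_cases hy : y = v <;> by_cases hx' : x = v <;>
      by_cases hy' : y = u <;> simp_all
  have h2 : ∀ a b : V, ∑ x ∈ A, ∑ y ∈ B, (if x = a then (if y = b then 1 else 0) else 0) =
      if a ∈ A ∧ b ∈ B then 1 else 0 := by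
    intro a b
    rw [ite_and]
    simp only [Finset.sum_ite_eq', Finset.sum_ite_irrel, Finset.sum_const_zero]
  simp only [pairCap, h1, Finset.sum_add_distrib, h2]
  have h3 : u ∈ A → u ∉ B := fun h h' => Finset.disjoint_left.1 hAB h h'
  by_cases u ∈ A <;> by_cases v ∈ B <;> by_cases v ∈ A <;> by_cases u ∈ B <;> simp_all

theorem starSum_decStar_add (H : CapGraph (Option V)) {v : V} {α : ℕ} (hα : α ≤ H.starCap v)
    (A : Finset V) :
    (H.decStar v α).starSum A + (if v ∈ A then α else 0) = H.starSum A := by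
  rw [← Finset.sum_ite_eq' A v (fun _ => α), starSum, starSum, ← Finset.sum_add_distrib]
  refine Finset.sum_congr rfl fun u _ => ?_
  rw [starCap_decStar]
  split_ifs with h
  · subst h; omega
  · rfl

theorem starSum_incStar (H : CapGraph (Option V)) (v : V) (α : ℕ) (A : Finset V) :
    (H.incStar v α).starSum A = H.starSum A + (if v ∈ A then α else 0) := by
  rw [← Finset.sum_ite_eq' A v (fun _ => α), starSum, starSum, ← Finset.sum_add_distrib]
  refine Finset.sum_congr rfl fun u _ => ?_
  rw [starCap_incStar]
  split_ifs with h <;> rfl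

theorem starSum_splitOff_add {H : CapGraph (Option V)} {u v : V} (h : H.CanSplit u v) (A : Finset V) :
    (H.splitOff u v).starSum A + (if u ∈ A then 1 else 0) + (if v ∈ A then 1 else 0) =
      H.starSum A := by
  rw [← Finset.sum_ite_eq' A u (fun _ => 1), ← Finset.sum_ite_eq' A v (fun _ => 1), starSum,
    starSum, ← Finset.sum_add_distrib, ← Finset.sum_add_distrib]
  refine Finset.sum_congr rfl fun w _ => ?_
  rw [starCap_splitOff]
  obtain ⟨h1, h2, h3⟩ := h
  by_cases hu : w = u
  · by_cases hv : w = v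
    · have := h3 (hu.symm.trans hv)
      subst hu
      simp only [hv, if_true] at *
      omega
    · subst hu
      simp only [hv, if_true, if_false]
      omega
  · by_cases hv : w = v
    · subst hv
      simp only [hu, if_true, if_false]
      omega
    · simp [hu, hv]

end Modified

theorem f_decStar_add (H : CapGraph (Option V)) (k : ℕ) {v : V} {α : ℕ} (hα : α ≤ H.starCap v)
    (X : Biset V) :
    (H.decStar v α).f k X.lift + (if v ∈ X.inner then α else 0) = H.f k X.lift := by
  have h : (H.decStar v α).pairCap X.inner X.outerᶜ = H.pairCap X.inner X.outerᶜ := by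
    simp [pairCap, decStar]
  have := starSum_decStar_add H hα X.inner
  rw [f_lift, f_lift, h]
  omega

theorem f_incStar (H : CapGraph (Option V)) (k : ℕ) (v : V) (α : ℕ) (X : Biset V) :
    (H.incStar v α).f k X.lift = H.f k X.lift + (if v ∈ X.inner then α else 0) := by
  have h : (H.incStar v α).pairCap X.inner X.outerᶜ = H.pairCap X.inner X.outerᶜ := by
    simp [pairCap, incStar]
  have := starSum_incStar H v α X.inner
  rw [f_lift, f_lift, h]
  omega

theorem f_splitOff_add {u v : V} (h : H.CanSplit u v) (X : Biset V) :
    (H.splitOff u v).f k X.lift + (if u ∈ X.inner then 1 else 0) + (if v ∈ X.inner then 1 else 0) =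
      H.f k X.lift +
        (if u ∈ X.inner ∧ v ∉ X.outer ∨ v ∈ X.inner ∧ u ∉ X.outer then 1 else 0) := by
  have h1 := starSum_splitOff_add h X.inner
  have h2 : (H.splitOff u v).pairCap X.inner X.outerᶜ = H.pairCap X.inner X.outerᶜ +
      (if u ∈ X.inner ∧ v ∉ X.outer ∨ v ∈ X.inner ∧ u ∉ X.outer then 1 else 0) := by
    by_cases huv : u = v
    · subst huv
      have h3 : ¬ (u ∈ X.inner ∧ u ∉ X.outer ∨ u ∈ X.inner ∧ u ∉ X.outer) := by
        have := @X.inner_subset u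
        tauto
      rw [if_neg h3]
      simp [pairCap, splitOff]
    · rw [pairCap_splitOff H huv]
      · simp only [Finset.mem_compl]
      · rw [Finset.disjoint_left]
        intro x hx hx'
        exact Finset.mem_compl.1 hx' (X.inner_subset hx)
  rw [f_lift, f_lift, h2]
  omega

theorem f_splitOff_le {u v : V} (h : H.CanSplit u v) (X : Biset V) :
    (H.splitOff u v).f k X.lift ≤ H.f k X.lift := by
  have := f_splitOff_add (k := k) h X
  split_ifs at this <;> first | omega | tauto

/-- If a pair of edges at `s` can be split off, but not admissibly, this is certified by a biset. -/
theorem exists_blocking (hH : H.ConnectedIn k) {u v : V} (h : H.CanSplit u v)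
    (hadm : ¬ H.Admissible k u v) :
    ∃ X : Biset V, X.Nontrivial ∧
      ((u ∈ X.inner ∧ v ∈ X.inner ∧ H.f k X.lift ≤ 2 * k + 1) ∨
        (u ∈ X.inner ∧ v ∈ X.wall ∧ H.f k X.lift = 2 * k) ∨
        (v ∈ X.inner ∧ u ∈ X.wall ∧ H.f k X.lift = 2 * k)) := by
  have h1 : ¬ (H.splitOff u v).ConnectedIn k := fun h' => hadm ⟨h, hH, h'⟩
  simp only [ConnectedIn, hH.1, true_and, not_forall, not_le] at h1
  obtain ⟨X, hX, hlt⟩ := h1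
  refine ⟨X, hX, ?_⟩
  have h2 := f_splitOff_add (k := k) h X
  have h3 := hH.le_f hX
  simp only [Biset.mem_wall]
  by_cases hu : u ∈ X.inner
  · by_cases hv : v ∈ X.inner
    · left
      have hu' := X.inner_subset hu
      have hv' := X.inner_subset hv
      simp only [hu, hv, hu', hv', if_true] at h2
      simp at h2
      exact ⟨hu, hv, by omega⟩
    · by_cases hv' : v ∈ X.outer
      · right; left
        simp [hu, hv, hv'] at h2
        exact ⟨hu, ⟨hv', hv⟩, by omega⟩
      · simp [hu, hv, hv'] at h2
        omega
  · by_cases hv : v ∈ X.inner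
    · by_cases hu' : u ∈ X.outer
      · right; right
        simp [hu, hv, hu'] at h2
        exact ⟨hv, ⟨hu', hu⟩, by omega⟩
      · simp [hu, hv, hu'] at h2
        omega
    · simp [hu, hv] at h2
      omega

end CapGraph

namespace CapGraph

variable {V : Type*} [Fintype V] [DecidableEq V] {H : CapGraph (Option V)} {k : ℕ}

/-! ### Uncrossing with tight bisets -/

theorem card_wall_le_one {X : Biset V} (h : H.f k X.lift < 2 * k + H.starSum X.inner) :
    X.wall.card ≤ 1 := by
  by_contra! h1
  have h2 := Nat.mul_le_mul_left k h1
  have h3 := mul_card_wall_add_starSum_le_f (H := H) (k := k) X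
  omega

/-- The union of `X` with a tight biset `B` whose wall is a vertex `t` of the inner set of `X` is
no worse than `X`, unless the outer sets cover `V`. In the latter case `X` has a large value. -/
theorem ConnectedIn.union_of_wall_eq (hH : H.ConnectedIn k) {X B : Biset V} {t : V}
    (hX : X.Nontrivial) (hB : B.Nontrivial) (ht : t ∈ X.inner) (hw : B.wall = {t})
    (hfB : H.f k B.lift = 2 * k) :
    (X.outer ∪ B.outer = Finset.univ ∧
        2 * k + H.starCap t + 2 * H.starSum (X.inner ∩ B.inner) ≤ H.f k X.lift) ∨
      ((X ∪ B).Nontrivial ∧ H.f k (X ∪ B).lift ≤ H.f k X.lift) := by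
  have htB : t ∈ B.outer ∧ t ∉ B.inner := Biset.mem_wall.1 (hw ▸ Finset.mem_singleton_self t)
  have htX := X.inner_subset ht
  by_cases hun : X.outer ∪ B.outer = Finset.univ
  · left
    refine ⟨hun, ?_⟩
    have hcov : ∀ v, v ∈ X.outer ∨ v ∈ B.outer := fun v =>
      Finset.mem_union.1 (hun ▸ Finset.mem_univ v)
    have h1 : 2 * k ≤ H.f k (B \ X).lift := by
      obtain ⟨z, hz⟩ := hX.exists_notMem
      have hzB : z ∈ B.inner := by
        by_contra hz'
        have h2 : z ∈ B.wall := Biset.mem_wall.2 ⟨(hcov z).resolve_left hz, hz'⟩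
        rw [hw, Finset.mem_singleton] at h2
        exact hz (h2 ▸ htX)
      exact hH.le_f (Biset.nontrivial_of_mem (x := z) (y := t) (by simp [hz, hzB]) (by simp [ht]))
    have h2 : 2 * k ≤ H.f k (X \ B).lift := by
      obtain ⟨y, hy⟩ := hB.1
      by_cases hsub : X.inner ⊆ B.outer
      · -- The inner set of `X \ B` is empty, but its wall consists of `t` and of a second vertex.
        obtain ⟨z, hz⟩ := hB.exists_notMem
        have hz1 : z ∈ X.outer := (hcov z).resolve_right hz
        have hz2 : z ∉ B.inner := fun h => hz (B.inner_subset h)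
        have hz3 : z ∉ X.inner := fun h => hz (hsub h)
        refine two_mul_le_f_of_mem_wall (x := t) (y := z) ?_ ?_ ?_
        · simp [Biset.mem_wall, htX, htB]
        · simp [Biset.mem_wall, hz1, hz2, hz3]
        · rintro rfl; exact hz htB.1
      · obtain ⟨x, hx1, hx2⟩ := Finset.not_subset.1 hsub
        exact hH.le_f (Biset.nontrivial_of_mem (x := x) (y := y) (by simp [hx1, hx2])
          (by simp [hy]))
    have h3 := f_sdiff_add_f_sdiff_le H k X B
    have h4 : H.starCap t ≤ H.starSum (X.inner ∩ B.wall) :=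
      starCap_le_starSum (by simp [ht, hw])
    omega
  · right
    have hnt : (X ∪ B).Nontrivial := ⟨⟨t, by simp [ht]⟩, hun⟩
    refine ⟨hnt, ?_⟩
    have h1 := f_inter_add_f_union_le H k X B
    by_cases hin : (X.inner ∩ B.inner).Nonempty
    · obtain ⟨y, hy⟩ := hX.exists_notMem
      have h2 : 2 * k ≤ H.f k (X ∩ B).lift := by
        obtain ⟨x, hx⟩ := hin
        exact hH.le_f (Biset.nontrivial_of_mem (x := x) (y := y) hx (by simp [hy]))
      omega
    · have hdisj : ∀ v, v ∈ X.inner → v ∉ B.inner := fun v h h' =>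
        hin ⟨v, Finset.mem_inter.2 ⟨h, h'⟩⟩
      have htw : t ∈ (X ∩ B).wall := by simp [Biset.mem_wall, htX, htB]
      by_cases hz : ∃ z ∈ (X ∩ B).wall, t ≠ z
      · obtain ⟨z, hz, hne⟩ := hz
        have h2 : 2 * k ≤ H.f k (X ∩ B).lift := two_mul_le_f_of_mem_wall htw hz hne
        omega
      · -- Here `B_I` is disjoint from `X_O`, and the edges between `t` and `B_I` are lost.
        push Not at hz
        have h2 : B.inner \ X.outer = B.inner := by
          rw [Finset.sdiff_eq_self_iff_disjoint, Finset.disjoint_left]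
          intro v hv hvX
          have hvX' : v ∉ X.inner := fun h => hdisj v h hv
          have := hz v (by simp [Biset.mem_wall, hvX, hvX', B.inner_subset hv])
          exact htB.2 (this ▸ hv)
        have h3 : X.inner ∩ B.wall = B.wall := by
          rw [hw]; exact Finset.inter_singleton_of_mem ht
        have h4 := hH.le_f_add_pairCap_wall hB (by rw [hw, Finset.card_singleton])
        have h5 := mul_card_wall_add_starSum_le_f (H := H) (k := k) (X ∩ B)
        have h6 : 1 ≤ (X ∩ B).wall.card := Finset.card_pos.2 ⟨t, htw⟩
        have h7 := Nat.mul_le_mul_left k h6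
        rw [h2, h3, pairCap_comm] at h1
        omega

/-- A difference of two bisets that meet and whose outer sets cover `V` has a large value, or it
has an empty inner set and many edges at its wall are lost in posimodularity. -/
theorem ConnectedIn.sdiff_of_union_eq_univ (hH : H.ConnectedIn k) {X Y : Biset V} {t : V}
    (hX : X.Nontrivial) (hY : Y.Nontrivial) (htY : t ∈ Y.inner)
    (hw : X.wall.card ≤ 1) (hun : X.outer ∪ Y.outer = Finset.univ) :
    2 * k ≤ H.f k (X \ Y).lift ∨
      (X.inner ⊆ Y.inner ∧ k ≤ H.f k (X \ Y).lift ∧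
        3 * k ≤ H.f k X.lift + H.pairCap (X.inner ∩ Y.inner) (X.wall \ Y.outer)) := by
  by_cases hsub : X.inner ⊆ Y.outer
  · obtain ⟨x, hx⟩ := hY.exists_notMem
    have hxO : x ∈ X.outer := (Finset.mem_union.1 (hun ▸ Finset.mem_univ x)).resolve_right hx
    have hxI : x ∉ X.inner := fun h => hx (hsub h)
    have hxY : x ∉ Y.inner := fun h => hx (Y.inner_subset h)
    have hxw : x ∈ X.wall := Biset.mem_wall.2 ⟨hxO, hxI⟩
    have hxw' : x ∈ (X \ Y).wall := by simp [Biset.mem_wall, hxO, hxI, hxY]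
    by_cases hsub' : X.inner ⊆ Y.inner
    · right
      refine ⟨hsub', ?_, ?_⟩
      · have h1 := mul_card_wall_add_starSum_le_f (H := H) (k := k) (X \ Y)
        have h2 : 1 ≤ (X \ Y).wall.card := Finset.card_pos.2 ⟨x, hxw'⟩
        have h3 := Nat.mul_le_mul_left k h2
        omega
      · have h1 : X.wall.card = 1 := le_antisymm hw (Finset.card_pos.2 ⟨x, hxw⟩)
        have h2 : X.wall = {x} := (Finset.eq_of_subset_of_card_le
          (Finset.singleton_subset_iff.2 hxw) (by rw [h1, Finset.card_singleton])).symm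
        have h3 : X.wall \ Y.outer = X.wall := by
          rw [h2, Finset.sdiff_eq_self_iff_disjoint, Finset.disjoint_singleton_left]
          exact hx
        rw [h3, Finset.inter_eq_left.2 hsub']
        exact hH.le_f_add_pairCap_wall hX h1
    · left
      obtain ⟨z, hz, hz'⟩ := Finset.not_subset.1 hsub'
      refine two_mul_le_f_of_mem_wall (x := x) (y := z) hxw' ?_ ?_
      · simp [Biset.mem_wall, hz, hz', hsub hz, X.inner_subset hz]
      · rintro rfl; exact hxI hz
  · left
    obtain ⟨x, hx1, hx2⟩ := Finset.not_subset.1 hsub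
    exact hH.le_f (Biset.nontrivial_of_mem (x := x) (y := t) (by simp [hx1, hx2])
      (by simp [htY]))

/-- The union of `Y` with a tight biset `X`, where `X_I ∩ Y_I` contains a neighbour of `s`, is no
worse than `Y`, if the value of `Y` is small in comparison with the number of edges between `s` and
its inner set. -/
theorem ConnectedIn.union_of_tight (hH : H.ConnectedIn k) {X Y : Biset V} {t : V}
    (hX : X.Nontrivial) (hY : Y.Nontrivial) (htX : t ∈ X.inner) (htY : t ∈ Y.inner)
    (ht : 0 < H.starCap t) (hfX : H.f k X.lift = 2 * k) (hfY : H.f k Y.lift ≤ 2 * k + 1)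
    (hfY' : H.f k Y.lift < 2 * k + H.starSum Y.inner) :
    (X ∪ Y).Nontrivial ∧ H.f k (X ∪ Y).lift ≤ H.f k Y.lift := by
  have h0 : H.starCap t ≤ H.starSum X.inner := starCap_le_starSum htX
  have hI : t ∈ X.inner ∩ Y.inner := Finset.mem_inter.2 ⟨htX, htY⟩
  have h1 : H.starCap t ≤ H.starSum (X.inner ∩ Y.inner) := starCap_le_starSum hI
  have hun : X.outer ∪ Y.outer ≠ Finset.univ := by
    intro hun
    have h2 := f_sdiff_add_f_sdiff_le H k X Y
    have h3 := hH.sdiff_of_union_eq_univ hX hY htY (card_wall_le_one (H := H) (k := k) (by omega)) hun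
    have h4 := hH.sdiff_of_union_eq_univ hY hX htX (card_wall_le_one (H := H) (k := k) (by omega))
      (by rwa [Finset.union_comm])
    rw [Finset.inter_comm Y.inner X.inner] at h4
    rcases h4 with h4 | ⟨h4, h5, h6⟩
    · rcases h3 with h3 | ⟨-, h3, h3'⟩ <;> omega
    · rw [Finset.inter_eq_right.2 h4] at h1 h2 h3 h6
      rcases h3 with h3 | ⟨-, h3, h3'⟩ <;> omega
  refine ⟨⟨⟨t, by simp [htX]⟩, hun⟩, ?_⟩
  obtain ⟨y, hy⟩ := hX.exists_notMem
  have h2 : 2 * k ≤ H.f k (X ∩ Y).lift :=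
    hH.le_f (Biset.nontrivial_of_mem (x := t) (y := y) hI (by simp [hy]))
  have h3 := f_inter_add_f_union_le H k X Y
  omega

/-! ### Maximal tight and dangerous bisets -/

/-- `X` is a tight biset with `t` in its inner set. -/
def TightAt (H : CapGraph (Option V)) (k : ℕ) (t : V) (X : Biset V) : Prop :=
  X.Nontrivial ∧ t ∈ X.inner ∧ H.f k X.lift = 2 * k

theorem exists_tightAt (hH : H.ConnectedIn k) {v : V} (hv : 0 < H.starCap v) (hU : v ∉ H.U k) :
    ∃ X, H.TightAt k v X := by
  have h1 : ¬ (H.decStar v 1).ConnectedIn k := fun h => hU ⟨hv, h⟩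
  simp only [ConnectedIn, hH.1, true_and, not_forall, not_le] at h1
  obtain ⟨X, hX, hlt⟩ := h1
  have h2 := f_decStar_add H k (α := 1) hv X
  have h3 := hH.le_f hX
  split_ifs at h2 with h
  · exact ⟨X, hX, h, by omega⟩
  · omega

theorem TightAt.notMem_U {v : V} {X : Biset V} (hX : H.TightAt k v X) : v ∉ H.U k := by
  rintro ⟨h1, h2⟩
  have h3 := h2.le_f hX.1
  have h4 := f_decStar_add H k h1 X
  rw [if_pos hX.2.1, hX.2.2] at h4
  omega

theorem le_of_wall_eq_of_maximal (hH : H.ConnectedIn k) {t : V} (ht : 0 < H.starCap t)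
    {X B : Biset V} (hX : Maximal (H.TightAt k t) X) (hB : B.Nontrivial) (hw : B.wall = {t})
    (hfB : H.f k B.lift = 2 * k) : B ≤ X := by
  obtain ⟨hX1, hX2, hX3⟩ := hX.prop
  rcases hH.union_of_wall_eq hX1 hB hX2 hw hfB with ⟨-, h⟩ | ⟨h1, h2⟩
  · omega
  · have h3 := hH.le_f h1
    have h4 : H.TightAt k t (X ∪ B) := ⟨h1, by simp [hX2], by omega⟩
    exact (Biset.le_union_right X B).trans (hX.le_of_ge h4 (Biset.le_union_left X B))

theorem le_of_tightAt_of_maximal (hH : H.ConnectedIn k) {t : V} (ht : 0 < H.starCap t)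
    {X Y : Biset V} (hX : Maximal (H.TightAt k t) X) (hY : H.TightAt k t Y) : Y ≤ X := by
  obtain ⟨hX1, hX2, hX3⟩ := hX.prop
  have h0 : H.starCap t ≤ H.starSum Y.inner := starCap_le_starSum hY.2.1
  obtain ⟨h1, h2⟩ := hH.union_of_tight hX1 hY.1 hX2 hY.2.1 ht hX3 (by rw [hY.2.2]; omega)
    (by rw [hY.2.2]; omega)
  have h3 := hH.le_f h1
  have h4 : H.TightAt k t (X ∪ Y) := ⟨h1, by simp [hX2], by rw [hY.2.2] at h2; omega⟩
  exact (Biset.le_union_right X Y).trans (hX.le_of_ge h4 (Biset.le_union_left X Y))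

/-- `Y` is maximal among the bisets above `X` of value at most `2k + 1`, and its inner set contains
a neighbour of `s` outside of `X`. -/
structure IsDangerousExtension (H : CapGraph (Option V)) (k : ℕ) (X Y : Biset V) : Prop where
  maximal : Maximal (fun Z => X ≤ Z ∧ Z.Nontrivial ∧ H.f k Z.lift ≤ 2 * k + 1) Y
  exists_mem : ∃ v ∈ Y.inner, v ∉ X.outer ∧ 0 < H.starCap v

/-- If `t` is in no admissible pair, then every neighbour of `s` outside of the maximal tight biset
`X` of `t` is in a dangerous extension of `X`: the bisets that block the pair by their wall are
contained in `X`. -/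
theorem exists_dangerousExtension (hH : H.ConnectedIn k) {t v : V} (ht : 0 < H.starCap t)
    (hv : 0 < H.starCap v) (hadm : ¬ H.Admissible k t v) {X : Biset V}
    (hX : Maximal (H.TightAt k t) X) (hvX : v ∉ X.outer) :
    ∃ Y, H.IsDangerousExtension k X Y ∧ v ∈ Y.inner := by
  obtain ⟨hX1, hX2, hX3⟩ := hX.prop
  have htv : t ≠ v := by
    rintro rfl
    exact hvX (X.inner_subset hX2)
  obtain ⟨Y, hY, h⟩ := exists_blocking hH ⟨ht, hv, fun h => absurd h htv⟩ hadm
  rcases h with ⟨htY, hvY, hfY⟩ | ⟨htY, hvY, hfY⟩ | ⟨hvY, htY, hfY⟩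
  · have h0 := starCap_add_le_starSum (H := H) htY hvY htv
    obtain ⟨h1, h2⟩ := hH.union_of_tight hX1 hY hX2 htY ht hX3 hfY (by omega)
    obtain ⟨Z, hZ1, hZ2⟩ := Biset.exists_le_maximal
      (P := fun Z => X ≤ Z ∧ Z.Nontrivial ∧ H.f k Z.lift ≤ 2 * k + 1)
      ⟨Biset.le_union_left X Y, h1, h2.trans hfY⟩
    have hvZ : v ∈ Z.inner := hZ1.1 (by simp [hvY])
    exact ⟨Z, ⟨hZ2, v, hvZ, hvX, hv⟩, hvZ⟩
  · exact absurd ((le_of_tightAt_of_maximal hH ht hX ⟨hY, htY, hfY⟩).2 (Biset.mem_wall.1 hvY).1) hvX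
  · have h0 : H.starCap v ≤ H.starSum Y.inner := starCap_le_starSum hvY
    have hw : Y.wall = {t} := (Finset.eq_of_subset_of_card_le
      (Finset.singleton_subset_iff.2 htY)
      (by rw [Finset.card_singleton]; exact card_wall_le_one (H := H) (k := k) (by omega))).symm
    exact absurd (X.inner_subset ((le_of_wall_eq_of_maximal hH ht hX hY hw hfY).1 hvY)) hvX

/-- The equalities that hold for two dangerous extensions `Y`, `Z` of a maximal tight biset if a
neighbour of `s` lies in `Z_I - Y_O`: there is no slack in their posimodular inequality. -/
structure IsCrossing (H : CapGraph (Option V)) (k : ℕ) (Y Z : Biset V) : Prop where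
  starSum_inter : H.starSum (Y.inner ∩ Z.inner) = 1
  starSum_left : H.starSum (Y.inner ∩ Z.wall) = 0
  starSum_right : H.starSum (Z.inner ∩ Y.wall) = 0
  pairCap_eq : H.pairCap (Y.inner ∩ Z.inner) (Y.outer ∪ Z.outer)ᶜ = 0
  f_left : H.f k (Y \ Z).lift = 2 * k
  f_right : H.f k (Z \ Y).lift = 2 * k

theorem IsCrossing.symm {Y Z : Biset V} (h : H.IsCrossing k Y Z) : H.IsCrossing k Z Y :=
  ⟨by rw [Finset.inter_comm]; exact h.1, h.3, h.2,
    by rw [Finset.inter_comm, Finset.union_comm]; exact h.4, h.6, h.5⟩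

section Extensions

variable {t : V} {X Y Z : Biset V}

theorem IsDangerousExtension.two_le_starSum (hX : H.TightAt k t X) (ht : 0 < H.starCap t)
    (hY : H.IsDangerousExtension k X Y) : 2 ≤ H.starSum Y.inner := by
  obtain ⟨v, hv, hvX, hpos⟩ := hY.exists_mem
  have htv : t ≠ v := by
    rintro rfl
    exact hvX (X.inner_subset hX.2.1)
  have := starCap_add_le_starSum (H := H) (hY.maximal.prop.1.1 hX.2.1) hv htv
  omega

theorem IsDangerousExtension.card_wall_le_one (hX : H.TightAt k t X) (ht : 0 < H.starCap t)
    (hY : H.IsDangerousExtension k X Y) : Y.wall.card ≤ 1 := by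
  have h1 := hY.two_le_starSum hX ht
  have h2 := hY.maximal.prop.2.2
  exact CapGraph.card_wall_le_one (H := H) (k := k) (by omega)

/-- Two dangerous extensions of a maximal tight biset `X` intersect in `X`, unless their outer sets
cover `V`. -/
theorem IsDangerousExtension.inter_eq (hH : H.ConnectedIn k) (hX : Maximal (H.TightAt k t) X)
    (hY : H.IsDangerousExtension k X Y) (hZ : H.IsDangerousExtension k X Z) (hne : Y ≠ Z)
    (hun : Y.outer ∪ Z.outer ≠ Finset.univ) : Y ∩ Z = X := by
  obtain ⟨hY1, hY2, hY3⟩ := hY.maximal.prop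
  obtain ⟨hZ1, hZ2, hZ3⟩ := hZ.maximal.prop
  obtain ⟨hX1, hX2, hX3⟩ := hX.prop
  have hle : X ≤ Y ∩ Z := Biset.le_inter hY1 hZ1
  have hnt : (Y ∪ Z).Nontrivial := ⟨⟨t, by simp [hY1.1 hX2]⟩, hun⟩
  have h1 : 2 * k + 2 ≤ H.f k (Y ∪ Z).lift := by
    by_contra! hlt
    have hp : X ≤ Y ∪ Z ∧ (Y ∪ Z).Nontrivial ∧ H.f k (Y ∪ Z).lift ≤ 2 * k + 1 :=
      ⟨hY1.trans (Biset.le_union_left Y Z), hnt, by omega⟩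
    have h2 := hY.maximal.le_of_ge hp (Biset.le_union_left Y Z)
    have h3 := hZ.maximal.le_of_ge hp (Biset.le_union_right Y Z)
    exact hne (le_antisymm ((Biset.le_union_left Y Z).trans h3)
      ((Biset.le_union_right Y Z).trans h2))
  obtain ⟨y, hy⟩ := hY2.exists_notMem
  have h2 : (Y ∩ Z).Nontrivial :=
    Biset.nontrivial_of_mem (x := t) (y := y) (hle.1 hX2) (by simp [hy])
  have h3 := hH.le_f h2
  have h4 := f_inter_add_f_union_le H k Y Z
  exact le_antisymm (hX.le_of_ge ⟨h2, hle.1 hX2, by omega⟩ hle) hle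

theorem IsDangerousExtension.isCrossing (hH : H.ConnectedIn k) (hX : Maximal (H.TightAt k t) X)
    (ht : 0 < H.starCap t) (hY : H.IsDangerousExtension k X Y)
    (hZ : H.IsDangerousExtension k X Z) {v : V} (hvZ : v ∈ Z.inner) (hvY : v ∉ Y.outer) :
    H.IsCrossing k Y Z := by
  obtain ⟨hY1, hY2, hY3⟩ := hY.maximal.prop
  obtain ⟨hZ1, hZ2, hZ3⟩ := hZ.maximal.prop
  have htY := hY1.1 hX.prop.2.1
  have htZ := hZ1.1 hX.prop.2.1
  have h1 : H.starCap t ≤ H.starSum (Y.inner ∩ Z.inner) := starCap_le_starSum (by simp [htY, htZ])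
  have h2 : 2 * k ≤ H.f k (Z \ Y).lift :=
    hH.le_f (Biset.nontrivial_of_mem (x := v) (y := t) (by simp [hvZ, hvY]) (by simp [htY]))
  have h3 := f_sdiff_add_f_sdiff_le H k Y Z
  have h4 : 2 * k ≤ H.f k (Y \ Z).lift := by
    by_cases hun : Y.outer ∪ Z.outer = Finset.univ
    · rcases hH.sdiff_of_union_eq_univ hY2 hZ2 htZ (hY.card_wall_le_one hX.prop ht) hun with
        h | ⟨h4, h5, h6⟩
      · exact h
      · have h7 := hY.two_le_starSum hX.prop ht
        rw [Finset.inter_eq_left.2 h4] at h3 h6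
        omega
    · obtain ⟨u, huY, huX, -⟩ := hY.exists_mem
      have hne : Y ≠ Z := by
        rintro rfl
        exact hvY (Y.inner_subset hvZ)
      have hint := hY.inter_eq hH hX hZ hne hun
      have huZ : u ∉ Z.outer := fun h => huX (by
        rw [← hint]; simp [h, Y.inner_subset huY])
      exact hH.le_f (Biset.nontrivial_of_mem (x := u) (y := t) (by simp [huY, huZ])
        (by simp [htZ]))
  constructor <;> omega

theorem IsCrossing.notMem_outer (h : H.IsCrossing k Y Z) (htY : t ∈ Y.inner) (htZ : t ∈ Z.inner)
    (ht : 0 < H.starCap t) {v : V} (hv : v ∈ Y.inner) (hvt : v ≠ t) (hpos : 0 < H.starCap v) :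
    v ∉ Z.outer := by
  intro hvZ
  by_cases hvZ' : v ∈ Z.inner
  · have := starCap_add_le_starSum (H := H) (A := Y.inner ∩ Z.inner) (u := v) (v := t)
      (by simp [hv, hvZ']) (by simp [htY, htZ]) hvt
    have := h.starSum_inter
    omega
  · have : H.starCap v ≤ H.starSum (Y.inner ∩ Z.wall) :=
      starCap_le_starSum (by simp [hv, Biset.mem_wall, hvZ, hvZ'])
    have := h.starSum_left
    omega

end Extensions

end CapGraph

namespace CapGraph

variable {V : Type*} [Fintype V] [DecidableEq V] {H : CapGraph (Option V)} {k : ℕ}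

/-! ### Admissible pairs from the absence of obstacles -/

/-- Three dangerous extensions of a maximal tight biset `X`, each containing a neighbour of `s`
outside of the others, cannot exist: no edge would leave `X` except for one edge to `s`. -/
theorem exists_mem_outer_of_isCrossing (hk : 2 ≤ k) (hH : H.ConnectedIn k) {t : V}
    (ht : 0 < H.starCap t) {X Y Z : Biset V} (hX : Maximal (H.TightAt k t) X)
    (hY : H.IsDangerousExtension k X Y) (hZ : H.IsDangerousExtension k X Z)
    (hYZ : H.IsCrossing k Y Z) (hadm : ∀ v, ¬ H.Admissible k t v) {v : V}
    (hv : 0 < H.starCap v) : v ∈ Y.outer ∨ v ∈ Z.outer := by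
  by_contra! hcon
  obtain ⟨hvY, hvZ⟩ := hcon
  have hX2 := hX.prop.2.1
  have htY := hY.maximal.prop.1.1 hX2
  have htZ := hZ.maximal.prop.1.1 hX2
  have hne : ∀ {u}, u ∉ X.outer → u ≠ t := by
    rintro u hu rfl
    exact hu (X.inner_subset hX2)
  obtain ⟨W, hW, hvW⟩ := exists_dangerousExtension hH ht hv (hadm v) hX
    (fun h => hvY (hY.maximal.prop.1.2 h))
  have htW := hW.maximal.prop.1.1 hX2
  have hYW := hY.isCrossing hH hX ht hW hvW hvY
  have hZW := hZ.isCrossing hH hX ht hW hvW hvZ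
  obtain ⟨y, hyY, hyX, hy⟩ := hY.exists_mem
  obtain ⟨z, hzZ, hzX, hz⟩ := hZ.exists_mem
  have hyZ := hYZ.notMem_outer htY htZ ht hyY (hne hyX) hy
  have hyW := hYW.notMem_outer htY htW ht hyY (hne hyX) hy
  have hzY := hYZ.symm.notMem_outer htZ htY ht hzZ (hne hzX) hz
  have hzW := hZW.notMem_outer htZ htW ht hzZ (hne hzX) hz
  have hneq : ∀ {A B : Biset V} {u : V}, u ∉ A.outer → u ∉ B.outer →
      A.outer ∪ B.outer ≠ Finset.univ := by
    intro A B u h1 h2 h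
    have := h ▸ Finset.mem_univ u
    simp [h1, h2] at this
  have h1 : Y ∩ Z = X := hY.inter_eq hH hX hZ
    (by rintro rfl; exact hyZ (Y.inner_subset hyY)) (hneq hvY hvZ)
  have h2 : Y ∩ W = X := hY.inter_eq hH hX hW
    (by rintro rfl; exact hyW (Y.inner_subset hyY)) (hneq hzY hzW)
  have h3 : Z ∩ W = X := hZ.inter_eq hH hX hW
    (by rintro rfl; exact hzW (Z.inner_subset hzZ)) (hneq hyZ hyW)
  have hzero : ∀ {A B : Biset V}, H.IsCrossing k A B → A ∩ B = X → ∀ x ∈ X.inner, ∀ u,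
      u ∉ A.outer → u ∉ B.outer → H.cap (some x) (some u) = 0 := by
    intro A B hAB hint x hx u huA huB
    have h4 := hAB.pairCap_eq
    rw [pairCap, Finset.sum_eq_zero_iff] at h4
    have h5 := h4 x (by rw [← Biset.inner_inter, hint]; exact hx)
    rw [Finset.sum_eq_zero_iff] at h5
    exact h5 u (by simp [huA, huB])
  have h4 : H.pairCap X.inner X.outerᶜ = 0 := by
    refine Finset.sum_eq_zero fun x hx => Finset.sum_eq_zero fun u hu => ?_
    rw [Finset.mem_compl] at hu
    have h5 : u ∉ Y.outer ∨ u ∉ Z.outer := by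
      by_contra! h; exact hu (by rw [← h1]; simp [h])
    have h6 : u ∉ Y.outer ∨ u ∉ W.outer := by
      by_contra! h; exact hu (by rw [← h2]; simp [h])
    have h7 : u ∉ Z.outer ∨ u ∉ W.outer := by
      by_contra! h; exact hu (by rw [← h3]; simp [h])
    by_cases h8 : u ∈ Y.outer
    · by_cases h9 : u ∈ Z.outer
      · tauto
      · exact hzero hZW h3 x hx u h9 (h6.resolve_left (not_not.2 h8))
    · by_cases h9 : u ∈ Z.outer
      · exact hzero hYW h2 x hx u h8 (h7.resolve_left (not_not.2 h9))
      · exact hzero hYZ h1 x hx u h8 h9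
  have h5 : H.starSum X.inner = 1 := by
    rw [← hYZ.starSum_inter, ← Biset.inner_inter, h1]
  have h6 := hX.prop.2.2
  rw [f_lift, h4, h5] at h6
  -- The value of `X` is `1` modulo `k`, but it is `2k`.
  have h7 : k ∣ 1 := by
    have h8 : k ∣ k * X.wall.card + 1 := ⟨2, by linarith⟩
    exact (Nat.dvd_add_right (Dvd.intro _ rfl)).1 h8
  have := Nat.le_of_dvd one_pos h7
  omega

/-- If tight bisets with wall `y` cover the neighbours of `s` other than `y`, then `y` is in no tight
inner set: the maximal one would contain all neighbours of `s`. -/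
theorem mem_U_of_covering (hH : H.ConnectedIn k) {y : V} (hy : 0 < H.starCap y)
    (hcov : ∀ v, 0 < H.starCap v → v ≠ y →
      ∃ B : Biset V, B.Nontrivial ∧ B.wall = {y} ∧ H.f k B.lift = 2 * k ∧ v ∈ B.inner) :
    y ∈ H.U k := by
  by_contra hU
  obtain ⟨X₀, hX₀⟩ := exists_tightAt hH hy hU
  obtain ⟨X, -, hX⟩ := Biset.exists_le_maximal hX₀
  obtain ⟨hX1, hX2, hX3⟩ := hX.prop
  have h1 := hH.starSum_inner_le hX1
  have h2 : H.starCap y ≤ H.starSum X.inner := starCap_le_starSum hX2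
  obtain ⟨v, hv, hpos⟩ := exists_mem_of_starSum_pos (H := H) (A := X.outerᶜ) (by omega)
  rw [Finset.mem_compl] at hv
  have hvy : v ≠ y := by
    rintro rfl
    exact hv (X.inner_subset hX2)
  obtain ⟨B, hB, hw, hf, hvB⟩ := hcov v hpos hvy
  exact hv (X.inner_subset ((le_of_wall_eq_of_maximal hH hy hX hB hw hf).1 hvB))

/-- If some neighbour `t` of `s` is in a tight inner set and in no admissible pair, then there is an
obstacle. -/
theorem exists_isObstacle (hk : 2 ≤ k) (hH : H.ConnectedIn k) (hdeg : Even (H.deg none)) {t : V}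
    (ht : 0 < H.starCap t) (htU : t ∉ H.U k) (hadm : ∀ v, ¬ H.Admissible k t v) :
    ∃ (𝓑 : Set (Biset V)) (y : V), H.IsObstacle k 𝓑 y := by
  obtain ⟨X₀, hX₀⟩ := exists_tightAt hH ht htU
  obtain ⟨X, -, hX⟩ := Biset.exists_le_maximal hX₀
  obtain ⟨hX1, hX2, hX3⟩ := hX.prop
  have hne : ∀ {u}, u ∉ X.outer → u ≠ t := by
    rintro u hu rfl
    exact hu (X.inner_subset hX2)
  -- Two crossing dangerous extensions `Y` and `Z` of `X`.
  obtain ⟨v₁, hv₁, hpos₁⟩ : ∃ v ∈ X.outerᶜ, 0 < H.starCap v := by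
    have h1 := hH.starSum_inner_le hX1
    have h2 : H.starCap t ≤ H.starSum X.inner := starCap_le_starSum hX2
    exact exists_mem_of_starSum_pos (by omega)
  obtain ⟨Y, hY, -⟩ := exists_dangerousExtension hH ht hpos₁ (hadm v₁) hX (Finset.mem_compl.1 hv₁)
  obtain ⟨v₂, hv₂, hpos₂⟩ : ∃ v ∈ Y.outerᶜ, 0 < H.starCap v := by
    have h1 := hH.starSum_inner_le hY.maximal.prop.2.1
    have h2 := hY.two_le_starSum hX.prop ht
    have h3 := hY.maximal.prop.2.2
    exact exists_mem_of_starSum_pos (by omega)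
  rw [Finset.mem_compl] at hv₂
  obtain ⟨Z, hZ, hv₂Z⟩ := exists_dangerousExtension hH ht hpos₂ (hadm v₂) hX
    (fun h => hv₂ (hY.maximal.prop.1.2 h))
  have hYZ := hY.isCrossing hH hX ht hZ hv₂Z hv₂
  have htY := hY.maximal.prop.1.1 hX2
  have htZ := hZ.maximal.prop.1.1 hX2
  -- Neighbours of `s` in the wall of one of the two are in the wall of the other one.
  have hwall : ∀ {A B : Biset V}, H.IsDangerousExtension k X A → H.IsDangerousExtension k X B →
      H.IsCrossing k A B → ∀ y ∈ A.wall, 0 < H.starCap y → y ∈ B.wall := by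
    intro A B hA hB hAB y hyA hy
    have htA := hA.maximal.prop.1.1 hX2
    have htB := hB.maximal.prop.1.1 hX2
    by_contra hyB
    have hyB' : y ∉ B.outer := by
      intro hyB'
      have hyB'' : y ∈ B.inner := by
        by_contra h
        exact hyB (Biset.mem_wall.2 ⟨hyB', h⟩)
      have h1 : H.starCap y ≤ H.starSum (B.inner ∩ A.wall) := starCap_le_starSum (by simp [*])
      have h2 := hAB.starSum_right
      omega
    have hyX : y ∉ X.outer := fun h => hyB' (hB.maximal.prop.1.2 h)
    obtain ⟨W, hW, hyW⟩ := exists_dangerousExtension hH ht hy (hadm y) hX hyX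
    have hBW := hB.isCrossing hH hX ht hW hyW hyB'
    obtain ⟨b, hbB, hbX, hb⟩ := hB.exists_mem
    have hbA := hAB.symm.notMem_outer htB htA ht hbB (hne hbX) hb
    have hbW := hBW.notMem_outer htB (hW.maximal.prop.1.1 hX2) ht hbB (hne hbX) hb
    have hAW : A ∩ W = X := by
      refine hA.inter_eq hH hX hW ?_ ?_
      · rintro rfl
        exact (Biset.mem_wall.1 hyA).2 hyW
      · intro h
        have := h ▸ Finset.mem_univ b
        simp [hbA, hbW] at this
    refine hyX ?_
    rw [← hAW]
    simp [(Biset.mem_wall.1 hyA).1, W.inner_subset hyW]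
  have hcover : ∀ v, 0 < H.starCap v → v ∈ Y.outer ∨ v ∈ Z.outer := fun v hv =>
    exists_mem_outer_of_isCrossing hk hH ht hX hY hZ hYZ hadm hv
  have hYI : ∀ v ∈ Y.inner, v ≠ t → 0 < H.starCap v → v ∉ Z.outer := fun v hv hvt hpos =>
    hYZ.notMem_outer htY htZ ht hv hvt hpos
  have hZI : ∀ v ∈ Z.inner, v ≠ t → 0 < H.starCap v → v ∉ Y.outer := fun v hv hvt hpos =>
    hYZ.symm.notMem_outer htZ htY ht hv hvt hpos
  have hcases : ∀ v, 0 < H.starCap v → v ≠ t → v ∉ Y.wall ∩ Z.wall →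
      (v ∈ Y.inner ∧ v ∉ Z.outer) ∨ (v ∈ Z.inner ∧ v ∉ Y.outer) := by
    intro v hv hvt hvw
    by_cases h1 : v ∈ Y.inner
    · exact Or.inl ⟨h1, hYI v h1 hvt hv⟩
    · by_cases h2 : v ∈ Z.inner
      · exact Or.inr ⟨h2, hZI v h2 hvt hv⟩
      · exfalso
        rcases hcover v hv with h3 | h3
        · have h4 : v ∈ Y.wall := Biset.mem_wall.2 ⟨h3, h1⟩
          exact hvw (Finset.mem_inter.2 ⟨h4, hwall hY hZ hYZ v h4 hv⟩)
        · have h4 : v ∈ Z.wall := Biset.mem_wall.2 ⟨h3, h2⟩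
          exact hvw (Finset.mem_inter.2 ⟨hwall hZ hY hYZ.symm v h4 hv, h4⟩)
  -- By parity, the common wall carries an odd number of edges to `s`.
  have hodd : Odd (H.starSum (Y.wall ∩ Z.wall)) := by
    have hct : H.starCap t = 1 := by
      have h1 : H.starCap t ≤ H.starSum (Y.inner ∩ Z.inner) :=
        starCap_le_starSum (by simp [htY, htZ])
      have h2 := hYZ.starSum_inter
      omega
    have half : ∀ {A B : Biset V}, H.IsDangerousExtension k X A → H.IsDangerousExtension k X B →
        t ∈ A.inner → t ∈ B.outer →
        (∀ v, 0 < H.starCap v → v ∉ A.outer → v ∈ B.inner) →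
        H.starSum (A.inner \ B.outer) ≤ H.starSum (B.inner \ A.outer) := by
      intro A B hA hB htA htB hAB
      have h1 := hH.starSum_inner_le hA.maximal.prop.2.1
      have h2 := hA.maximal.prop.2.2
      have h3 : H.starSum ({t} ∪ (A.inner \ B.outer)) ≤ H.starSum A.inner :=
        starSum_mono (Finset.union_subset (Finset.singleton_subset_iff.2 htA)
          Finset.sdiff_subset)
      have h4 : H.starSum A.outerᶜ ≤ H.starSum (B.inner \ A.outer) :=
        starSum_le_of_nbhd fun v hv hpos => Finset.mem_sdiff.2
          ⟨hAB v hpos (Finset.mem_compl.1 hv), Finset.mem_compl.1 hv⟩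
      rw [starSum_union (by simp [htB])] at h3
      have h5 : H.starSum {t} = 1 := by rw [starSum_singleton, hct]
      omega
    have hnot : ∀ {A B : Biset V}, H.IsDangerousExtension k X A → H.IsDangerousExtension k X B →
        H.IsCrossing k A B → (∀ v, 0 < H.starCap v → v ∈ A.outer ∨ v ∈ B.outer) →
        ∀ v, 0 < H.starCap v → v ∉ A.outer → v ∈ B.inner := by
      intro A B hA hB hAB hc v hv hvA
      by_contra hvB
      have h1 : v ∈ B.wall := Biset.mem_wall.2 ⟨(hc v hv).resolve_left hvA, hvB⟩
      exact hvA (Biset.mem_wall.1 (hwall hB hA hAB.symm v h1 hv)).1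
    have h1 := half hY hZ htY (Z.inner_subset htZ) (hnot hY hZ hYZ hcover)
    have h2 := half hZ hY htZ (Y.inner_subset htY)
      (hnot hZ hY hYZ.symm fun v hv => (hcover v hv).symm)
    have h3 : H.starSum Finset.univ =
        H.starSum ((({t} ∪ (Y.inner \ Z.outer)) ∪ (Z.inner \ Y.outer)) ∪ (Y.wall ∩ Z.wall)) := by
      refine le_antisymm (starSum_le_of_nbhd fun v _ hv => ?_) (starSum_mono (Finset.subset_univ _))
      by_cases hvt : v = t
      · simp [hvt]
      · by_cases hvw : v ∈ Y.wall ∩ Z.wall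
        · exact Finset.mem_union_right _ hvw
        · have := hcases v hv hvt hvw
          simp only [Finset.mem_union, Finset.mem_sdiff]
          tauto
    have htYO := Y.inner_subset htY
    have htZO := Z.inner_subset htZ
    rw [starSum_union, starSum_union, starSum_union, starSum_singleton, hct,
      ← deg_none] at h3
    · rw [h3] at hdeg
      have h4 : 1 + H.starSum (Y.inner \ Z.outer) + H.starSum (Z.inner \ Y.outer) +
          H.starSum (Y.wall ∩ Z.wall) =
          2 * H.starSum (Y.inner \ Z.outer) + 1 + H.starSum (Y.wall ∩ Z.wall) := by omega
      rw [h4] at hdeg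
      rw [← Nat.not_even_iff_odd]
      intro h5
      exact Nat.not_even_iff_odd.2 (odd_two_mul_add_one _) ((Nat.even_add.1 hdeg).2 h5)
    · simp [htZO]
    · rw [Finset.disjoint_left]
      intro v hv hv'
      rw [Finset.mem_sdiff] at hv'
      rcases Finset.mem_union.1 hv with h | h
      · rw [Finset.mem_singleton] at h
        exact hv'.2 (h ▸ htYO)
      · exact hv'.2 (Y.inner_subset (Finset.mem_sdiff.1 h).1)
    · rw [Finset.disjoint_left]
      intro v hv hv'
      simp only [Finset.mem_union, Finset.mem_singleton, Finset.mem_sdiff] at hv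
      simp only [Finset.mem_inter, Biset.mem_wall] at hv'
      rcases hv with (rfl | h) | h
      · exact hv'.1.2 htY
      · exact hv'.1.2 h.1
      · exact hv'.2.2 h.1
  obtain ⟨y, hyw, hy⟩ := exists_mem_of_starSum_pos hodd.pos
  rw [Finset.mem_inter] at hyw
  have hsingle : ∀ {A : Biset V}, A.wall.card ≤ 1 → y ∈ A.wall → A.wall = {y} := fun h1 h2 =>
    (Finset.eq_of_subset_of_card_le (Finset.singleton_subset_iff.2 h2) (by simpa using h1)).symm
  have hYw := hsingle (hY.card_wall_le_one hX.prop ht) hyw.1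
  have hZw := hsingle (hZ.card_wall_le_one hX.prop ht) hyw.2
  have hyodd : Odd (H.starCap y) := by
    rw [hYw, hZw, Finset.inter_self, starSum_singleton] at hodd
    exact hodd
  have hyY := Biset.mem_wall.1 hyw.1
  have hyZ := Biset.mem_wall.1 hyw.2
  have hyt : y ≠ t := by
    rintro rfl
    exact hyY.2 htY
  -- The wall of `X` is `y` as well.
  have hyX : y ∈ X.outer := by
    by_contra hyX
    obtain ⟨W, hW, hyW⟩ := exists_dangerousExtension hH ht hy (hadm y) hX hyX
    have htW := hW.maximal.prop.1.1 hX2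
    have hun : ∀ {A : Biset V}, H.IsDangerousExtension k X A → y ∈ A.outer ∧ y ∉ A.inner →
        A.outer ∪ W.outer = Finset.univ := by
      intro A hA hyA
      by_contra hne'
      have hAW : A ∩ W = X := by
        refine hA.inter_eq hH hX hW ?_ hne'
        rintro rfl
        exact hyA.2 hyW
      refine hyX ?_
      rw [← hAW]
      simp [hyA.1, W.inner_subset hyW]
    have h1 := hH.starSum_inner_le hW.maximal.prop.2.1
    have h2 := hW.two_le_starSum hX.prop ht
    have h3 := hW.maximal.prop.2.2
    obtain ⟨v, hvW, hv⟩ := exists_mem_of_starSum_pos (H := H) (A := W.outerᶜ) (by omega)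
    rw [Finset.mem_compl] at hvW
    have hvY : v ∈ Y.outer :=
      (Finset.mem_union.1 (hun hY hyY ▸ Finset.mem_univ v)).resolve_right hvW
    have hvZ : v ∈ Z.outer :=
      (Finset.mem_union.1 (hun hZ hyZ ▸ Finset.mem_univ v)).resolve_right hvW
    have hvt : v ≠ t := by
      rintro rfl
      exact hvW (W.inner_subset htW)
    have hvw : v ∉ Y.wall ∩ Z.wall := by
      rw [hYw, hZw, Finset.inter_self, Finset.mem_singleton]
      rintro rfl
      exact hvW (W.inner_subset hyW)
    rcases hcases v hv hvt hvw with h | h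
    · exact h.2 hvZ
    · exact h.2 hvY
  have hXw : X.wall = {y} := by
    have h1 : H.starCap t ≤ H.starSum X.inner := starCap_le_starSum hX2
    refine hsingle (card_wall_le_one (H := H) (k := k) (by omega)) (Biset.mem_wall.2 ⟨hyX, ?_⟩)
    exact fun h => hyY.2 (hY.maximal.prop.1.1 h)
  have hdw : ∀ {A B : Biset V}, A.wall = {y} → B.wall = {y} → (A \ B).wall = {y} := by
    intro A B hA hB
    have hyA : y ∈ A.wall := by simp [hA]
    have hyB : y ∈ B.wall := by simp [hB]
    rw [Biset.mem_wall] at hyA hyB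
    ext v
    have h1 : v ∈ A.outer → v ∉ A.inner → v = y := fun h h' =>
      Finset.mem_singleton.1 (hA ▸ Biset.mem_wall.2 ⟨h, h'⟩)
    have h2 : v ∈ B.outer → v ∉ B.inner → v = y := fun h h' =>
      Finset.mem_singleton.1 (hB ▸ Biset.mem_wall.2 ⟨h, h'⟩)
    simp only [Biset.mem_wall, Biset.outer_sdiff, Biset.inner_sdiff, Finset.mem_sdiff,
      Finset.mem_singleton]
    constructor
    · rintro ⟨⟨h3, h4⟩, h5⟩
      by_cases h6 : v ∈ A.inner
      · by_cases h7 : v ∈ B.outer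
        · exact h2 h7 h4
        · exact absurd ⟨h6, h7⟩ h5
      · exact h1 h3 h6
    · rintro rfl
      exact ⟨⟨hyA.1, hyB.2⟩, fun h => hyA.2 h.1⟩
  have hYZn : (Y \ Z).Nontrivial := by
    obtain ⟨u, huY, huX, hu⟩ := hY.exists_mem
    exact Biset.nontrivial_of_mem (x := u) (y := t)
      (by simp [huY, hYI u huY (hne huX) hu]) (by simp [htZ])
  have hZYn : (Z \ Y).Nontrivial :=
    Biset.nontrivial_of_mem (x := v₂) (y := t) (by simp [hv₂Z, hv₂]) (by simp [htY])
  have hcov : ∀ v, 0 < H.starCap v → v ≠ y →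
      v ∈ X.inner ∨ v ∈ (Y \ Z).inner ∨ v ∈ (Z \ Y).inner := by
    intro v hv hvy
    by_cases hvt : v = t
    · exact Or.inl (hvt ▸ hX2)
    · right
      have := hcases v hv hvt (by rw [hYw, hZw]; simpa using hvy)
      simpa using this
  refine ⟨{X, Y \ Z, Z \ Y}, y, hy, hyodd, ?_, ?_, ?_, ?_, ?_, ?_⟩
  · refine mem_U_of_covering hH hy fun v hv hvy => ?_
    rcases hcov v hv hvy with h | h | h
    · exact ⟨X, hX1, hXw, hX3, h⟩
    · exact ⟨Y \ Z, hYZn, hdw hYw hZw, hYZ.f_left, h⟩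
    · exact ⟨Z \ Y, hZYn, hdw hZw hYw, hYZ.f_right, h⟩
  · rintro B (rfl | rfl | rfl)
    exacts [hX1, hYZn, hZYn]
  · rintro B (rfl | rfl | rfl)
    exacts [hXw, hdw hYw hZw, hdw hZw hYw]
  · rintro B (rfl | rfl | rfl)
    exacts [hX3, hYZ.f_left, hYZ.f_right]
  · have hd1 : Disjoint X.inner (Y \ Z).inner := by
      rw [Finset.disjoint_left]
      intro v h1 h2
      exact (Finset.mem_sdiff.1 h2).2 (Z.inner_subset (hZ.maximal.prop.1.1 h1))
    have hd2 : Disjoint X.inner (Z \ Y).inner := by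
      rw [Finset.disjoint_left]
      intro v h1 h2
      exact (Finset.mem_sdiff.1 h2).2 (Y.inner_subset (hY.maximal.prop.1.1 h1))
    have hd3 : Disjoint (Y \ Z).inner (Z \ Y).inner := by
      rw [Finset.disjoint_left]
      intro v h1 h2
      exact (Finset.mem_sdiff.1 h2).2 (Y.inner_subset (Finset.mem_sdiff.1 h1).1)
    rintro B (rfl | rfl | rfl) B' (rfl | rfl | rfl) hBB'
    exacts [absurd rfl hBB', hd1, hd2, hd1.symm, absurd rfl hBB', hd3, hd2.symm, hd3.symm,
      absurd rfl hBB']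
  · rintro v ⟨hv, hvy⟩
    rcases hcov v hv hvy with h | h | h
    · exact Set.mem_iUnion₂.2 ⟨X, by simp, h⟩
    · exact Set.mem_iUnion₂.2 ⟨Y \ Z, by simp, h⟩
    · exact Set.mem_iUnion₂.2 ⟨Z \ Y, by simp, h⟩

end CapGraph

namespace CapGraph

variable {V : Type*} [Fintype V] [DecidableEq V] {H : CapGraph (Option V)} {k : ℕ}

/-- If no neighbour of `s` is in a tight inner set, then bisets of value `2k + 1` can be uncrossed
as if they were tight, and there is an admissible pair. -/
theorem exists_admissible_of_nbhd_subset_U (hH : H.ConnectedIn k) (hdeg : Even (H.deg none))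
    {t : V} (ht : 0 < H.starCap t) (hU : H.starNbhd ⊆ H.U k) : ∃ u v, H.Admissible k u v := by
  by_contra! hadm
  have hf : ∀ {X : Biset V}, X.Nontrivial → ∀ v ∈ X.inner, 0 < H.starCap v →
      2 * k + 1 ≤ H.f k X.lift := by
    intro X hX v hv hpos
    have h1 := hH.le_f hX
    have h2 : H.f k X.lift ≠ 2 * k := fun h => TightAt.notMem_U ⟨hX, hv, h⟩ (hU hpos)
    omega
  have hblock : ∀ {v}, H.CanSplit t v → ∃ Y : Biset V, Y.Nontrivial ∧ t ∈ Y.inner ∧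
      v ∈ Y.inner ∧ H.f k Y.lift ≤ 2 * k + 1 := by
    intro v hv
    obtain ⟨Y, hY, h⟩ := exists_blocking hH hv (hadm t v)
    rcases h with ⟨htY, hvY, hfY⟩ | ⟨htY, -, hfY⟩ | ⟨hvY, -, hfY⟩
    · exact ⟨Y, hY, htY, hvY, hfY⟩
    · have := hf hY t htY ht
      omega
    · have := hf hY v hvY hv.2.1
      omega
  obtain ⟨Y₀, hY₀⟩ : ∃ Y : Biset V, Y.Nontrivial ∧ t ∈ Y.inner ∧ H.f k Y.lift ≤ 2 * k + 1 ∧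
      2 ≤ H.starSum Y.inner := by
    by_cases hv : ∃ v, v ≠ t ∧ 0 < H.starCap v
    · obtain ⟨v, hvt, hv⟩ := hv
      obtain ⟨Y, hY, htY, hvY, hfY⟩ := hblock ⟨ht, hv, fun h => absurd h.symm hvt⟩
      have := starCap_add_le_starSum (H := H) htY hvY hvt.symm
      exact ⟨Y, hY, htY, hfY, by omega⟩
    · push Not at hv
      have h1 : H.starSum Finset.univ ≤ H.starSum {t} := starSum_le_of_nbhd fun v _ hpos => by
        by_contra h
        have := hv v (by simpa using h)
        omega
      have h2 : H.starCap t ≤ H.starSum Finset.univ := starCap_le_starSum (Finset.mem_univ t)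
      rw [starSum_singleton] at h1
      rw [deg_none] at hdeg
      have h3 : 2 ≤ H.starCap t := by
        obtain ⟨m, hm⟩ := hdeg
        omega
      obtain ⟨Y, hY, htY, -, hfY⟩ := hblock ⟨ht, ht, fun _ => h3⟩
      have h4 : H.starCap t ≤ H.starSum Y.inner := starCap_le_starSum htY
      exact ⟨Y, hY, htY, hfY, by omega⟩
  obtain ⟨Y, -, hY⟩ := Biset.exists_le_maximal
    (P := fun Y => Y.Nontrivial ∧ t ∈ Y.inner ∧ H.f k Y.lift ≤ 2 * k + 1 ∧
      2 ≤ H.starSum Y.inner) hY₀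
  obtain ⟨hY1, htY, hfY, hsY⟩ := hY.prop
  have h1 := hH.starSum_inner_le hY1
  obtain ⟨v, hvY, hv⟩ := exists_mem_of_starSum_pos (H := H) (A := Y.outerᶜ) (by omega)
  rw [Finset.mem_compl] at hvY
  have htv : t ≠ v := by
    rintro rfl
    exact hvY (Y.inner_subset htY)
  obtain ⟨Z, hZ, htZ, hvZ, hfZ⟩ := hblock ⟨ht, hv, fun h => absurd h htv⟩
  have hI : t ∈ Y.inner ∩ Z.inner := Finset.mem_inter.2 ⟨htY, htZ⟩
  by_cases hun : Y.outer ∪ Z.outer = Finset.univ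
  · have h2 : H.starCap t ≤ H.starSum (Y.inner ∩ Z.inner) := starCap_le_starSum hI
    have h3 : 2 * k + 1 ≤ H.f k (Z \ Y).lift :=
      hf (Biset.nontrivial_of_mem (x := v) (y := t) (by simp [hvZ, hvY]) (by simp [htY])) v
        (by simp [hvZ, hvY]) hv
    have h4 := f_sdiff_add_f_sdiff_le H k Y Z
    rcases hH.sdiff_of_union_eq_univ hY1 hZ htZ
      (card_wall_le_one (H := H) (k := k) (by omega)) hun with h | ⟨h5, h6, h7⟩
    · omega
    · rw [Finset.inter_eq_left.2 h5] at h4 h7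
      omega
  · obtain ⟨y, hy⟩ := hY1.exists_notMem
    have h2 : 2 * k + 1 ≤ H.f k (Y ∩ Z).lift :=
      hf (Biset.nontrivial_of_mem (x := t) (y := y) hI (by simp [hy])) t hI ht
    have h3 := f_inter_add_f_union_le H k Y Z
    have h4 : H.starSum Y.inner ≤ H.starSum (Y ∪ Z).inner :=
      starSum_mono Finset.subset_union_left
    have h5 := hY.le_of_ge (y := Y ∪ Z)
      ⟨⟨⟨t, by simp [htY]⟩, hun⟩, by simp [htY], by omega, by omega⟩ (Biset.le_union_left Y Z)
    exact hvY (Y.inner_subset (h5.1 (by simp [hvZ])))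

/-- If the degree of `s` is even and positive and there is no obstacle, then there is an admissible
pair. -/
theorem exists_admissible (hk : 2 ≤ k) (hH : H.ConnectedIn k) (hdeg : Even (H.deg none))
    {t : V} (ht : 0 < H.starCap t) (hobs : ¬ ∃ (𝓑 : Set (Biset V)) (y : V), H.IsObstacle k 𝓑 y) :
    ∃ u v, H.Admissible k u v := by
  by_cases hU : H.starNbhd ⊆ H.U k
  · exact exists_admissible_of_nbhd_subset_U hH hdeg ht hU
  · obtain ⟨u, hu, huU⟩ := Set.not_subset.1 hU
    by_contra! hadm
    exact hobs (exists_isObstacle hk hH hdeg hu huU (hadm u))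

/-! ### Graphs without obstacles -/

/-- `t` cannot be the special vertex of an obstacle if it is in the inner set of a biset of value at
most `2k + 1`: otherwise the maximal such biset and the bisets of the obstacle determine the parity
of the degree of `s`. -/
theorem IsObstacle.lt_f (hH : H.ConnectedIn k) (hdeg : Even (H.deg none)) {𝓑 : Set (Biset V)}
    {t : V} (h𝓑 : H.IsObstacle k 𝓑 t) {X : Biset V} (hX : X.Nontrivial) (htX : t ∈ X.inner) :
    2 * k + 1 < H.f k X.lift := by
  by_contra! hfX
  obtain ⟨Z, -, hZ⟩ := Biset.exists_le_maximal
    (P := fun Z => Z.Nontrivial ∧ t ∈ Z.inner ∧ H.f k Z.lift ≤ 2 * k + 1) ⟨hX, htX, hfX⟩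
  obtain ⟨hZ1, htZ, hfZ⟩ := hZ.prop
  have ht : 0 < H.starCap t := h𝓑.special_mem
  have hcases : ∀ B ∈ 𝓑, B ≤ Z ∨ (Z.outer ∪ B.outer = Finset.univ ∧ H.starCap t = 1 ∧
      H.starSum (Z.inner ∩ B.inner) = 0) := by
    intro B hB
    rcases hH.union_of_wall_eq hZ1 (h𝓑.nontrivial B hB) htZ (h𝓑.wall_eq B hB) (h𝓑.f_eq B hB) with
      ⟨h1, h2⟩ | ⟨h1, h2⟩
    · exact Or.inr ⟨h1, by omega, by omega⟩
    · exact Or.inl ((Biset.le_union_right Z B).trans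
        (hZ.le_of_ge ⟨h1, by simp [htZ], by omega⟩ (Biset.le_union_left Z B)))
  have hcov : ∀ v, 0 < H.starCap v → v ≠ t → ∃ B ∈ 𝓑, v ∈ B.inner := by
    intro v hv hvt
    simpa using h𝓑.covering ⟨hv, hvt⟩
  have hhalf := hH.starSum_inner_le hZ1
  have hle : H.starCap t ≤ H.starSum Z.inner := starCap_le_starSum htZ
  rw [deg_none] at hdeg
  obtain ⟨m, hm⟩ := hdeg
  by_cases hall : ∀ B ∈ 𝓑, B ≤ Z
  · have hnb : ∀ v, 0 < H.starCap v → v ∈ Z.inner := by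
      intro v hv
      by_cases hvt : v = t
      · exact hvt ▸ htZ
      · obtain ⟨B, hB, hvB⟩ := hcov v hv hvt
        exact (hall B hB).1 hvB
    have h1 : H.starSum Z.outerᶜ = 0 := starSum_eq_zero fun v hv hpos =>
      Finset.mem_compl.1 hv (Z.inner_subset (hnb v hpos))
    have h2 : H.starSum Finset.univ ≤ H.starSum Z.inner :=
      starSum_le_of_nbhd fun v _ hpos => hnb v hpos
    have h3 : H.starSum Z.inner ≤ H.starSum Finset.univ := starSum_mono (Finset.subset_univ _)
    omega
  · push Not at hall
    obtain ⟨B, hB, hBZ⟩ := hall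
    obtain ⟨hun, hct, hI⟩ := (hcases B hB).resolve_left hBZ
    have htB : t ∈ B.outer := by
      have : t ∈ B.wall := by simp [h𝓑.wall_eq B hB]
      exact (Biset.mem_wall.1 this).1
    -- All other members of the collection lie below `Z`.
    have hother : ∀ B' ∈ 𝓑, B' ≠ B → B' ≤ Z := by
      intro B' hB' hne
      rcases hcases B' hB' with h | ⟨hun', -, -⟩
      · exact h
      · exfalso
        obtain ⟨z, hz⟩ := hZ1.exists_notMem
        have hmem : ∀ A ∈ 𝓑, Z.outer ∪ A.outer = Finset.univ → z ∈ A.inner := by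
          intro A hA h
          have h1 := (Finset.mem_union.1 (h ▸ Finset.mem_univ z)).resolve_left hz
          by_contra h2
          have h3 : z ∈ A.wall := Biset.mem_wall.2 ⟨h1, h2⟩
          rw [h𝓑.wall_eq A hA, Finset.mem_singleton] at h3
          exact hz (h3 ▸ Z.inner_subset htZ)
        exact Finset.disjoint_left.1 (h𝓑.disjoint B' hB' B hB hne) (hmem B' hB' hun')
          (hmem B hB hun)
    have hnb : ∀ v, 0 < H.starCap v → v ∈ Z.inner ∨ v ∈ B.inner := by
      intro v hv
      by_cases hvt : v = t
      · exact Or.inl (hvt ▸ htZ)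
      · obtain ⟨B', hB', hvB⟩ := hcov v hv hvt
        by_cases hBB : B' = B
        · exact Or.inr (hBB ▸ hvB)
        · exact Or.inl ((hother B' hB' hBB).1 hvB)
    have h1 : H.starSum B.inner ≤ H.starSum (B.inner \ Z.inner) := by
      refine starSum_le_of_nbhd fun v hv hpos => Finset.mem_sdiff.2 ⟨hv, fun hvZ => ?_⟩
      have : H.starCap v ≤ H.starSum (Z.inner ∩ B.inner) := starCap_le_starSum (by simp [hv, hvZ])
      omega
    have h2 : H.starSum (B.inner \ Z.inner) ≤ H.starSum B.inner := starSum_mono Finset.sdiff_subset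
    have h3 : H.starSum Finset.univ = H.starSum Z.inner + H.starSum (B.inner \ Z.inner) := by
      rw [← starSum_union Finset.disjoint_sdiff]
      refine le_antisymm (starSum_le_of_nbhd fun v _ hpos => ?_)
        (starSum_mono (Finset.subset_univ _))
      simpa using hnb v hpos
    have h4 : H.starSum Z.outerᶜ ≤ H.starSum B.inner := starSum_le_of_nbhd fun v hv hpos =>
      (hnb v hpos).resolve_left fun h => Finset.mem_compl.1 hv (Z.inner_subset h)
    have h5 : H.starSum ({t} ∪ B.outerᶜ) ≤ H.starSum Z.inner := by
      refine starSum_le_of_nbhd fun v hv hpos => ?_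
      rcases Finset.mem_union.1 hv with h | h
      · exact Finset.mem_singleton.1 h ▸ htZ
      · exact (hnb v hpos).resolve_right fun h' => Finset.mem_compl.1 h (B.inner_subset h')
    rw [starSum_union (by simp [htB]), starSum_singleton, hct] at h5
    have h6 := hH.starSum_inner_le (h𝓑.nontrivial B hB)
    rw [h𝓑.f_eq B hB] at h6
    omega

/-- The properties of a minimal even extension that survive admissible splitting offs: it is
`(2,k)`-connected in `V`, the degree of `s` is even, and every neighbour of `s` is in the inner set of
a biset that is tight up to one. -/
structure IsNearlyTight (k : ℕ) (H : CapGraph (Option V)) : Prop where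
  connectedIn : H.ConnectedIn k
  even_deg : Even (H.deg none)
  exists_biset : ∀ v, 0 < H.starCap v →
    ∃ X : Biset V, X.Nontrivial ∧ v ∈ X.inner ∧ H.f k X.lift ≤ 2 * k + 1

theorem IsNearlyTight.not_isObstacle (hH : H.IsNearlyTight k) :
    ¬ ∃ (𝓑 : Set (Biset V)) (t : V), H.IsObstacle k 𝓑 t := by
  rintro ⟨𝓑, t, h𝓑⟩
  obtain ⟨X, hX, htX, hfX⟩ := hH.exists_biset t h𝓑.special_mem
  exact hfX.not_gt (h𝓑.lt_f hH.connectedIn hH.even_deg hX htX)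

theorem deg_splitOff_add_two {u v : V} (h : H.CanSplit u v) :
    (H.splitOff u v).deg none + 2 = H.deg none := by
  have := starSum_splitOff_add h Finset.univ
  rw [deg_none, deg_none]
  simpa using this

theorem IsNearlyTight.splitOff (hH : H.IsNearlyTight k) {u v : V} (h : H.Admissible k u v) :
    (H.splitOff u v).IsNearlyTight k where
  connectedIn := h.2.2
  even_deg := by
    have h1 := hH.even_deg
    rw [← deg_splitOff_add_two h.1] at h1
    simpa [Nat.even_add] using h1
  exists_biset w hw := by
    rw [starCap_splitOff] at hw
    obtain ⟨X, hX, hwX, hfX⟩ := hH.exists_biset w (by omega)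
    exact ⟨X, hX, hwX, (f_splitOff_le h.1 X).trans hfX⟩

theorem IsNearlyTight.of_admissibleSeries {H' : CapGraph (Option V)} (hH : H.IsNearlyTight k)
    (h : AdmissibleSeries k H H') : H'.IsNearlyTight k := by
  induction h with
  | refl => exact hH
  | tail _ hstep ih =>
    obtain ⟨u, v, hadm, rfl⟩ := hstep
    exact ih.splitOff hadm

theorem IsNearlyTight.hasCompleteAdmissibleSplittingOff (hk : 2 ≤ k) (hH : H.IsNearlyTight k) :
    H.HasCompleteAdmissibleSplittingOff k := by
  induction hn : H.deg none using Nat.strong_induction_on generalizing H with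
  | _ n ih =>
    by_cases hnb : ∃ t, 0 < H.starCap t
    · obtain ⟨t, ht⟩ := hnb
      obtain ⟨u, v, hadm⟩ :=
        exists_admissible hk hH.connectedIn hH.even_deg ht hH.not_isObstacle
      have h1 := deg_splitOff_add_two hadm.1
      obtain ⟨H', h2, h3⟩ := ih _ (by omega) (hH.splitOff hadm) rfl
      exact ⟨H', Relation.ReflTransGen.head ⟨u, v, hadm, rfl⟩ h2, h3⟩
    · push Not at hnb
      exact ⟨H, Relation.ReflTransGen.refl, fun v => Nat.le_zero.1 (hnb v)⟩

/-! ### Minimal even extensions -/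

theorem connectedIn_addStar (hV : 3 ≤ Fintype.card V) (k : ℕ) (G : CapGraph V) :
    (G.addStar (2 * k)).ConnectedIn k := by
  refine ⟨hV, fun X hX => ?_⟩
  obtain ⟨v, hv⟩ := hX.1
  have h1 : (G.addStar (2 * k)).starCap v ≤ (G.addStar (2 * k)).starSum X.inner :=
    starCap_le_starSum hv
  have h2 := mul_card_wall_add_starSum_le_f (H := G.addStar (2 * k)) (k := k) X
  have h3 : (G.addStar (2 * k)).starCap v = 2 * k := rfl
  omega

theorem exists_decStarMax_eq (hH : H.ConnectedIn k) (v : V) :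
    ∃ α ≤ H.starCap v, H.decStarMax k v = H.decStar v α ∧ (H.decStar v α).ConnectedIn k ∧
      (α < H.starCap v → ¬ (H.decStar v (α + 1)).ConnectedIn k) := by
  classical
  have h0 : (H.decStar v 0).ConnectedIn k := by
    refine ⟨hH.1, fun X hX => ?_⟩
    have h1 := f_decStar_add H k (Nat.zero_le (H.starCap v)) X
    have h2 := hH.le_f hX
    simp only [ite_self, add_zero] at h1
    omega
  refine ⟨_, Nat.findGreatest_le _, rfl, ?_, fun h => ?_⟩
  · exact Nat.findGreatest_spec (P := fun α => (H.decStar v α).ConnectedIn k)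
      (Nat.zero_le (H.starCap v)) h0
  · exact Nat.findGreatest_is_greatest (P := fun α => (H.decStar v α).ConnectedIn k)
      (Nat.lt_succ_self _) h

/-- After the maximal decrease of the capacity of `sv`, the vertex `v` is not a neighbour of `s` or
is in a tight inner set. -/
theorem exists_tightAt_decStarMax (hH : H.ConnectedIn k) {v : V}
    (hv : 0 < (H.decStarMax k v).starCap v) : ∃ X, (H.decStarMax k v).TightAt k v X := by
  obtain ⟨α, hα, heq, hcon, hmax⟩ := exists_decStarMax_eq hH v
  rw [heq] at hv ⊢
  rw [starCap_decStar, if_pos rfl] at hv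
  have h1 := hmax (by omega)
  simp only [ConnectedIn, hH.1, true_and, not_forall, not_le] at h1
  obtain ⟨X, hX, hlt⟩ := h1
  have h2 := f_decStar_add H k hα X
  have h3 := f_decStar_add H k (v := v) (α := α + 1) (by omega) X
  have h4 := hcon.le_f hX
  split_ifs at h2 h3 with h
  · exact ⟨X, hX, h, by omega⟩
  · omega

theorem TightAt.decStarMax (hH : H.ConnectedIn k) {u v : V} {X : Biset V}
    (hX : H.TightAt k u X) : (H.decStarMax k v).TightAt k u X := by
  obtain ⟨α, hα, heq, hcon, -⟩ := exists_decStarMax_eq hH v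
  rw [heq]
  have h1 := f_decStar_add H k hα X
  have h2 := hcon.le_f hX.1
  have h3 := hX.2.2
  exact ⟨hX.1, hX.2.1, by omega⟩

theorem foldl_decStarMax (k : ℕ) (l : List V) (H : CapGraph (Option V)) (hH : H.ConnectedIn k)
    (hl : ∀ v, v ∉ l → 0 < H.starCap v → ∃ X, H.TightAt k v X) :
    (l.foldl (decStarMax k) H).ConnectedIn k ∧
      ∀ v, 0 < (l.foldl (decStarMax k) H).starCap v →
        ∃ X, (l.foldl (decStarMax k) H).TightAt k v X := by
  induction l generalizing H with
  | nil => exact ⟨hH, fun v => hl v (by simp)⟩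
  | cons a l ih =>
    obtain ⟨α, hα, heq, hcon, -⟩ := exists_decStarMax_eq hH a
    refine ih _ (heq ▸ hcon) fun v hv hpos => ?_
    by_cases hva : v = a
    · subst hva
      exact exists_tightAt_decStarMax hH hpos
    · rw [heq, starCap_decStar, if_neg hva] at hpos
      obtain ⟨X, hX⟩ := hl v (by simp [hva, hv]) hpos
      exact ⟨X, hX.decStarMax hH⟩

theorem IsMinimalEvenExtension.isNearlyTight (hV : 3 ≤ Fintype.card V) {G : CapGraph V}
    (hH : IsMinimalEvenExtension k G H) : H.IsNearlyTight k := by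
  obtain ⟨v, hv⟩ := hH
  obtain ⟨hcon, htight⟩ := foldl_decStarMax k (List.ofFn v) (G.addStar (2 * k))
    (connectedIn_addStar hV k G) fun u hu => by
      refine absurd ?_ hu
      rw [List.mem_ofFn]
      exact v.surjective u
  change (greedyExtension k G v).ConnectedIn k at hcon
  change ∀ u, 0 < (greedyExtension k G v).starCap u →
    ∃ X, (greedyExtension k G v).TightAt k u X at htight
  rcases hv with ⟨heven, rfl⟩ | ⟨hodd, i, hi, rfl⟩
  · refine ⟨hcon, heven, fun u hu => ?_⟩
    obtain ⟨X, hX, huX, hf⟩ := htight u hu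
    exact ⟨X, hX, huX, by omega⟩
  · refine ⟨⟨hV, fun X hX => ?_⟩, ?_, fun u hu => ?_⟩
    · have h1 := hcon.le_f hX
      rw [f_incStar]
      omega
    · rw [deg_none, starSum_incStar, if_pos (Finset.mem_univ _), ← deg_none]
      exact hodd.add_one
    · -- The increased capacity was odd, so no new neighbour of `s` arises.
      have hpos : 0 < (greedyExtension k G v).starCap u := by
        rw [starCap_incStar] at hu
        split_ifs at hu with h
        · have h1 : Odd ((greedyExtension k G v).starCap (v i)) := hi.1
          rw [h]
          exact h1.pos
        · exact hu
      obtain ⟨X, hX, huX, hf⟩ := htight u hpos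
      refine ⟨X, hX, huX, ?_⟩
      rw [f_incStar, hf]
      split_ifs <;> omega

end CapGraph

theorem mainTheorem4 {V : Type*} [Fintype V] [DecidableEq V] (hV : 3 ≤ Fintype.card V)
    (k : ℕ) (hk : 2 ≤ k) (G : CapGraph V) (H H₁ : CapGraph (Option V))
    (hH : CapGraph.IsMinimalEvenExtension k G H) (hH₁ : CapGraph.AdmissibleSeries k H H₁) :
    (¬ ∃ (𝓑 : Set (Biset V)) (t : V), H₁.IsObstacle k 𝓑 t) ∧
      H₁.HasCompleteAdmissibleSplittingOff k :=
  have h := (hH.isNearlyTight hV).of_admissibleSeries hH₁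
  ⟨h.not_isObstacle, h.hasCompleteAdmissibleSplittingOff hk⟩
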